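/- Let $d\ge 2$ and let $I=(I_n)_{n\ge1}$ be a sequence of integers satisfying the Dold relations, i.e. there are integers $a_k$, $k\ge1$, such that $$I_n=\sum_{k\ge 1}a_k\sigma^k_n\quad\text{for all } n\ge1,\qquad \sigma^k_n=\begin{cases}k&\text{if } k\mid n,\\0&\text{otherwise.}\end{cases}$$ Then there are a continuous map $f:\mathbb R^d\to\mathbb R^d$ and a fixed point $p$ of $f$ such that 1. for every $n\ge 1$, $p$ is an isolated fixed point of $f^n$ and $i(f^n,p)=I_n$; 2. $p$ is not accumulated by other periodic orbits of $f$. Moreover, $f$ can be chosen so that $p$ is the origin $o$ and $\mathrm{Per}(f)=\mathrm{Fix}(f)=\{o\}$. Here $\mathrm{Fix}(f)$ and $\mathrm{Per}(f)$ are the sets of fixed and of periodic points of $f$. If $p$ is an isolated fixed point of a continuous map $g:\mathbb R^d\to\mathbb R^d$, the fixed point index $i(g,p)$ is the degree of the map $\partial B\to S^{d-1}$, $x\mapsto\frac{x-g(x)}{\|x-g(x)\|}$, where $B$ is any closed ball of positive radius centered at $p$ with $\mathrm{Fix}(g)\cap B=\{p\}$. -/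

import Mathlib

open scoped ContDiff

/-- The Euclidean space `ℝ^d`. -/
abbrev Euc (d : ℕ) : Type := EuclideanSpace ℝ (Fin d)

/-- The normalized sequence `σ^k`, indexed by the positive integers:
`σ^k_n = k` if `n` is a multiple of `k`, and `0` otherwise. -/
def normalizedSeq (k n : ℕ+) : ℤ := if (k : ℕ) ∣ (n : ℕ) then (k : ℤ) else 0

/-- `I` satisfies the Dold relations: it is a formal integer combination `∑_{k ≥ 1} a_k σ^k` of
the normalized sequences. As `σ^k_n = 0` for `k > n`, the `n`-th term of the formal sum is the
sum over `1 ≤ k ≤ n`. -/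
def DoldRelations (I : ℕ+ → ℤ) : Prop :=
  ∃ a : ℕ+ → ℤ, ∀ n : ℕ+, I n = ∑ k ∈ Finset.Icc 1 n, a k * normalizedSeq k n

/-- The signed number of zeros of `G` in the open ball `B(p, r)` is `m`: all the zeros are
nondegenerate, there are finitely many of them, and the sum of the signs of the Jacobian
determinants of `G` at them equals `m`. -/
def HasSignedZeroCount {d : ℕ} (G : Euc d → Euc d) (p : Euc d) (r : ℝ) (m : ℤ) : Prop :=
  (∀ x ∈ Metric.ball p r, G x = 0 → (fderiv ℝ G x).det ≠ 0) ∧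
  ∃ S : Finset (Euc d), (∀ x, x ∈ S ↔ x ∈ Metric.ball p r ∧ G x = 0) ∧
    ∑ x ∈ S, ((SignType.sign (fderiv ℝ G x).det : SignType) : ℤ) = m

/-- The Brouwer degree of the continuous map `φ : ∂B(p, r) → S^{d-1}` is `m`. The degree is the
signed number of zeros in `B(p, r)` of a smooth map `G`, all of whose zeros in the ball are
nondegenerate and which on the boundary sphere has no zeros and is such that `G / ‖G‖` is
homotopic to `φ`. (Such maps `G` always exist, and the number does not depend on `G`.) -/
def HasBrouwerDegree {d : ℕ} {p : Euc d} {r : ℝ}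
    (φ : C(Metric.sphere p r, Metric.sphere (0 : Euc d) 1)) (m : ℤ) : Prop :=
  ∃ G : Euc d → Euc d, ContDiff ℝ ∞ G ∧
    (∃ ψ : C(Metric.sphere p r, Metric.sphere (0 : Euc d) 1),
      (∀ x : Metric.sphere p r, (ψ x : Euc d) = ‖G x‖⁻¹ • G x) ∧ φ.Homotopic ψ) ∧
    HasSignedZeroCount G p r m

/-- The closed ball of radius `r > 0` about `p` isolates `p` as a fixed point of `f`:
`Fix(f) ∩ B = {p}`. -/
def IsolatesFixedPoint {d : ℕ} (f : Euc d → Euc d) (p : Euc d) (r : ℝ) : Prop :=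
  0 < r ∧ Function.fixedPoints f ∩ Metric.closedBall p r = {p}

/-- `p` is an isolated fixed point of `f` and the fixed point index `i(f, p)` equals `m`: for each
closed ball `B` about `p` with `Fix(f) ∩ B = {p}`, the map
`∂B → S^{d-1}, x ↦ (x - f x) / ‖x - f x‖` (is well defined, continuous and) has degree `m`. -/
def HasFixedPointIndex {d : ℕ} (f : Euc d → Euc d) (p : Euc d) (m : ℤ) : Prop :=
  (∃ r, IsolatesFixedPoint f p r) ∧
  ∀ r, IsolatesFixedPoint f p r →
    ∃ φ : C(Metric.sphere p r, Metric.sphere (0 : Euc d) 1),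
      (∀ x : Metric.sphere p r,
        (φ x : Euc d) = ‖(x : Euc d) - f x‖⁻¹ • ((x : Euc d) - f x)) ∧
      HasBrouwerDegree φ m

/-!
The theorem is first proved in the plane. A positively homogeneous map `f` of the plane acts on the
rays from the origin, and the index of `f^n` at the origin is the winding number of
`z - f^n z` along the unit circle. Dividing by `z`, this is `1` plus the winding number of
`q z = 1 - f^n z / z`, and `q` crosses the negative real axis just at the rays that `f^n` maps into
themselves with a factor greater than `1`. Such a ray contributes `-1` if it attracts the
neighbouring rays, and `1` if it repels them (`hasWinding_sub_of_slopes`). So `|a_k|` periodic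
orbits of `k` such rays each, attracting or repelling according to the sign of `a_k`, are needed for
every `k` at once, while `f` has to be continuous and no other rays may be fixed.

The map `planarMap` achieves this by a drift with jumps. Let rays in the right half-plane be given
by their slopes. In the sector of slopes at most `1/2` the map is linear: it doubles both the slope
of a ray and the first coordinate, and so the rays drift away from the ray of slope `0`, the only
fixed one. Slopes in a sequence of disjoint intervals in `(3/4, 1)`, the bumps, jump: a ray `u` of a
bump of period `k + 1` goes to the ray of slope `2^(-k) R u`, where `R` is affine and fixes the
centre of the bump, and after `k` steps of drift it is back at the slope `R u`. As these steps
multiply lengths by `2^k`, the jump may contract lengths by a factor of the order `2^(-k)`. This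
factor tends to `0` as `k` grows, and this is why the infinitely many jumps form a continuous map.
The map `R` is constant for an attracting orbit, and has slope `2` for a repelling one. All other
rays that leave the drift are mapped to `0` in at most two steps.
The orbits are computed in `iterate_planarMap_bump_returns` and `iterate_planarMap_slopePoint`, and
the winding number in `hasWinding_sub_iterate_planarMap`. It is the one wanted, up to a constant
`2` (from the identity and from the ray of slope `0`), which is removed from the coefficient of
`σ¹`.

A winding number is handled through a continuous logarithm of `z ↦ v z / z ^ m` (`HasWinding`).
Two loops that are never opposite have the same winding number (`HasWinding.of_ne_neg_mul`), and a
loop is compared in this way with a product of explicit loops with a single crossing each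
(`hasWinding_of_crossings`). In `ℝ^d` the planar map is extended by a constant in the complementary
directions; then the displacement is the identity in these directions, and its degree is the planar
winding number (`hasFixedPointIndex_of_hasWinding`).
-/

/-! ### Winding numbers -/

/-- The continuous function `v` on the unit circle has no zeros and winding number `m` about `0`.
This is encoded by a continuous logarithm of `z ↦ v z / z ^ m`. -/
def HasWinding (v : Circle → ℂ) (m : ℤ) : Prop :=
  ∃ L : C(Circle, ℂ), ∀ z, v z = (z : ℂ) ^ m * Complex.exp (L z)

namespace HasWinding

theorem continuous {v : Circle → ℂ} {m : ℤ} (h : HasWinding v m) : Continuous v := by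
  obtain ⟨L, hL⟩ := h
  have : v = fun z : Circle => ((z ^ m : Circle) : ℂ) * Complex.exp (L z) := by
    ext z
    simp [hL]
  rw [this]
  have hpow : Continuous fun z : Circle => z ^ m := continuous_zpow m
  exact (hpow.subtype_val).mul L.continuous.cexp

theorem ne_zero {v : Circle → ℂ} {m : ℤ} (h : HasWinding v m) (z : Circle) : v z ≠ 0 := by
  obtain ⟨L, hL⟩ := h
  rw [hL]
  exact mul_ne_zero (zpow_ne_zero _ z.coe_ne_zero) (Complex.exp_ne_zero _)

theorem mul {v w : Circle → ℂ} {m n : ℤ} (hv : HasWinding v m) (hw : HasWinding w n) :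
    HasWinding (fun z => v z * w z) (m + n) := by
  obtain ⟨L, hL⟩ := hv
  obtain ⟨K, hK⟩ := hw
  refine ⟨L + K, fun z => ?_⟩
  simp only [hL, hK]
  rw [zpow_add₀ z.coe_ne_zero, ContinuousMap.add_apply, Complex.exp_add]
  ring

theorem const {c : ℂ} (hc : c ≠ 0) : HasWinding (fun _ => c) 0 :=
  ⟨ContinuousMap.const _ (Complex.log c), fun z => by simp [Complex.exp_log hc]⟩

theorem coe : HasWinding (fun z => (z : ℂ)) 1 :=
  ⟨0, fun z => by simp⟩

theorem conj {v : Circle → ℂ} {m : ℤ} (hv : HasWinding v m) :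
    HasWinding (fun z => starRingEnd ℂ (v z)) (-m) := by
  obtain ⟨L, hL⟩ := hv
  refine ⟨⟨fun z => starRingEnd ℂ (L z), Complex.continuous_conj.comp L.continuous⟩, fun z => ?_⟩
  simp [hL, Complex.exp_conj, ← Circle.coe_inv_eq_conj]

theorem prod {ι : Type*} (T : Finset ι) {v : ι → Circle → ℂ} {m : ι → ℤ}
    (h : ∀ i ∈ T, HasWinding (v i) (m i)) :
    HasWinding (fun z => ∏ i ∈ T, v i z) (∑ i ∈ T, m i) := by
  classical
  induction T using Finset.induction_on with
  | empty => simpa using const one_ne_zero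
  | insert i T hi ih =>
    simp only [Finset.prod_insert hi, Finset.sum_insert hi]
    exact (h i (Finset.mem_insert_self i T)).mul
      (ih fun j hj => h j (Finset.mem_insert_of_mem hj))

/-- A form of Rouché's theorem: two loops, one of which never is a nonpositive multiple of the
other, have the same winding number. The logarithm of their quotient is the principal one. -/
theorem of_ne_neg_mul {u v : Circle → ℂ} {m : ℤ} (hu : HasWinding u m) (hv : Continuous v)
    (h : ∀ z, ∀ c : ℝ, 0 ≤ c → v z ≠ -c * u z) : HasWinding v m := by
  have hslit : ∀ z, v z / u z ∈ Complex.slitPlane := by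
    intro z
    by_contra hz
    rw [Complex.mem_slitPlane_iff_not_le_zero, not_not] at hz
    have hre : v z / u z = ((v z / u z).re : ℂ) := 
      Complex.ext rfl (by simpa using (Complex.le_def.1 hz).2)
    refine h z (-(v z / u z).re) ?_ ?_
    · have := (Complex.le_def.1 hz).1
      simpa using this
    · rw [Complex.ofReal_neg, neg_neg, ← hre, div_mul_cancel₀ _ (hu.ne_zero z)]
  have hcont : Continuous fun z => Complex.log (v z / u z) :=
    (hv.div hu.continuous hu.ne_zero).clog hslit
  have := hu.mul (w := fun z => v z / u z) (n := 0)
    ⟨⟨_, hcont⟩, fun z => by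
      simp [Complex.exp_log (Complex.slitPlane_ne_zero (hslit z))]⟩
  convert this using 1
  · ext z
    rw [mul_div_cancel₀ _ (hu.ne_zero z)]
  · simp

end HasWinding

/-- The linear form on the plane that vanishes on the line of slope `t`. -/
def slopeForm (t : ℝ) (z : ℂ) : ℝ := z.im - t * z.re

/-- A loop which is a positive real outside the sector `|im z / re z - t| < δ`, `0 < re z`, and
which crosses the negative real axis exactly once, on the ray of slope `t` in the middle of the
sector. In the sector its imaginary part has the sign of `σ * (t - im z / re z)`. -/
noncomputable def crossingLoop (σ : ℤ) (t δ : ℝ) (z : ℂ) : ℂ :=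
  ⟨|slopeForm t z| - δ * z.re / 2, -(σ * (slopeForm t z * max 0 (δ * z.re - |slopeForm t z|)))⟩

theorem continuous_crossingLoop (σ : ℤ) (t δ : ℝ) : Continuous (crossingLoop σ t δ) := by
  have : crossingLoop σ t δ = fun z => (((|slopeForm t z| - δ * z.re / 2 : ℝ) : ℂ) +
      ((-(σ * (slopeForm t z * max 0 (δ * z.re - |slopeForm t z|))) : ℝ) : ℂ) * Complex.I) := by
    ext z
    exact Complex.mk_eq_add_mul_I _ _
  rw [this]
  unfold slopeForm
  fun_prop

theorem crossingLoop_eq_pos {σ : ℤ} {t δ : ℝ} (hδ : 0 < δ) {z : Circle}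
    (h : δ * (z : ℂ).re ≤ |slopeForm t z|) :
    ∃ r : ℝ, 0 < r ∧ crossingLoop σ t δ z = r := by
  refine ⟨|slopeForm t z| - δ * (z : ℂ).re / 2, ?_, ?_⟩
  · rcases lt_trichotomy (z : ℂ).re 0 with h0 | h0 | h0
    · have := mul_neg_of_pos_of_neg hδ h0
      linarith [abs_nonneg (slopeForm t z)]
    · have h1 : (z : ℂ).im ≠ 0 := fun h1 => z.coe_ne_zero (Complex.ext h0 h1)
      simpa [slopeForm, h0] using h1
    · have := mul_pos hδ h0
      linarith
  · apply Complex.ext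
    · simp [crossingLoop]
    · simp [crossingLoop, max_eq_left (sub_nonpos.2 h)]

/-- The crossing loop of sign `1` turns in the same direction as the loop `z ↦ -z / z₀`, where
`z₀` is on the ray of slope `t`: the two loops are in the same open half-plane, or one is positive
and the other is not negative, or both are negative. -/
theorem hasWinding_crossingLoop_one {t δ : ℝ} (hδ : 0 < δ) :
    HasWinding (fun z => crossingLoop 1 t δ z) 1 := by
  have h0 : (-(1 + t * Complex.I)⁻¹ : ℂ) ≠ 0 := by
    rw [neg_ne_zero]
    refine inv_ne_zero fun h => ?_
    simpa using congrArg Complex.re h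
  have hw := (HasWinding.const h0).mul HasWinding.coe
  rw [zero_add] at hw
  refine hw.of_ne_neg_mul ((continuous_crossingLoop 1 t δ).comp continuous_subtype_val) ?_
  intro z c hc h
  have hs : 0 < 1 + t * t := by linarith [mul_self_nonneg t]
  have hre := congrArg Complex.re h
  have him := congrArg Complex.im h
  simp only [crossingLoop, Complex.mul_re, Complex.mul_im, Complex.neg_re, Complex.neg_im,
    Complex.inv_re, Complex.inv_im, Complex.normSq_apply, Complex.ofReal_re, Complex.ofReal_im,
    Complex.add_re, Complex.add_im, Complex.one_re, Complex.one_im, Complex.I_re,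
    Complex.I_im, mul_zero, mul_one, zero_mul, sub_zero, add_zero, zero_add, neg_zero, one_mul,
    Int.cast_one] at hre him
  have hre' : |slopeForm t z| - δ * (z : ℂ).re / 2 =
      c / (1 + t * t) * ((z : ℂ).re + t * (z : ℂ).im) := by
    rw [hre]; ring
  have him' : -(slopeForm t z * max 0 (δ * (z : ℂ).re - |slopeForm t z|)) =
      c / (1 + t * t) * slopeForm t z := by
    rw [him, slopeForm]; ring
  have hc' : 0 ≤ c / (1 + t * t) := div_nonneg hc hs.le
  generalize c / (1 + t * t) = e at hre' him' hc'
  by_cases ha : slopeForm t z = 0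
  · have h1 : (z : ℂ).im = t * (z : ℂ).re := by
      unfold slopeForm at ha; linarith
    rw [ha, h1] at hre'
    have h2 : (δ / 2 + e * (1 + t * t)) * (z : ℂ).re = 0 := by
      rw [abs_zero] at hre'
      linarith
    have h3 : (z : ℂ).re = 0 := by
      rcases mul_eq_zero.1 h2 with h | h
      · have : 0 ≤ e * (1 + t * t) := mul_nonneg hc' hs.le
        linarith
      · exact h
    exact z.coe_ne_zero (Complex.ext h3 (by rw [h1, h3]; simp))
  · have h1 : (max 0 (δ * (z : ℂ).re - |slopeForm t z|) + e) * slopeForm t z = 0 := by linarith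
    have h2 := (mul_eq_zero.1 h1).resolve_right ha
    have h3 := le_max_left 0 (δ * (z : ℂ).re - |slopeForm t z|)
    have he : e = 0 := by linarith
    have hm : max 0 (δ * (z : ℂ).re - |slopeForm t z|) = 0 := by linarith
    obtain ⟨r, hr, hr'⟩ := crossingLoop_eq_pos (σ := 1) hδ
      (sub_nonpos.1 ((le_max_right _ _).trans hm.le))
    have := congrArg Complex.re hr'
    simp only [crossingLoop, Complex.ofReal_re] at this
    rw [he, zero_mul] at hre'
    linarith

theorem hasWinding_crossingLoop {σ : ℤ} (hσ : σ = 1 ∨ σ = -1) {t δ : ℝ} (hδ : 0 < δ) :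
    HasWinding (fun z => crossingLoop σ t δ z) σ := by
  rcases hσ with rfl | rfl
  · exact hasWinding_crossingLoop_one hδ
  · convert (hasWinding_crossingLoop_one (t := t) hδ).conj using 2 with z
    apply Complex.ext <;> simp [crossingLoop]

/-- The winding number of a loop is the number of its crossings of the negative real axis, counted
with signs. The crossings take place on the rays of slope `t i`; the sectors about these rays are
disjoint, and in the `i`-th one the imaginary part has the sign of
`σ i * (t i - im z / re z)` unless the loop is at a positive real. -/
theorem hasWinding_of_crossings {ι : Type*} (T : Finset ι) (σ : ι → ℤ) (t δ : ι → ℝ)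
    (hσ : ∀ i ∈ T, σ i = 1 ∨ σ i = -1) (hδ : ∀ i ∈ T, 0 < δ i)
    (hdisj : ∀ z : Circle, ∀ i ∈ T, ∀ j ∈ T, |slopeForm (t i) z| < δ i * (z : ℂ).re →
      |slopeForm (t j) z| < δ j * (z : ℂ).re → i = j)
    {q : Circle → ℂ} (hq : Continuous q)
    (hout : ∀ z : Circle, (∀ i ∈ T, δ i * (z : ℂ).re ≤ |slopeForm (t i) z|) →
      q z ∈ Complex.slitPlane)
    (hin : ∀ z : Circle, ∀ i ∈ T, |slopeForm (t i) z| < δ i * (z : ℂ).re →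
      (slopeForm (t i) z = 0 ∧ (q z).im = 0 ∧ (q z).re < 0) ∨
      (slopeForm (t i) z ≠ 0 ∧ (((q z).im = 0 ∧ 0 < (q z).re) ∨
        (q z).im * (σ i * slopeForm (t i) z) < 0))) :
    HasWinding q (∑ i ∈ T, σ i) := by
  classical
  refine (HasWinding.prod T fun i hi =>
    hasWinding_crossingLoop (hσ i hi) (t := t i) (hδ i hi)).of_ne_neg_mul hq ?_
  intro z c hc h
  have hpos : ∀ S ⊆ T, (∀ i ∈ S, δ i * (z : ℂ).re ≤ |slopeForm (t i) z|) →
      ∃ r : ℝ, 0 < r ∧ ∏ i ∈ S, crossingLoop (σ i) (t i) (δ i) z = r := by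
    intro S hS hS'
    refine Finset.prod_induction _ (fun w : ℂ => ∃ r : ℝ, 0 < r ∧ w = r) ?_ ⟨1, one_pos, by simp⟩
      fun i hi => crossingLoop_eq_pos (hδ i (hS hi)) (hS' i hi)
    rintro _ _ ⟨r, hr, rfl⟩ ⟨s, hs, rfl⟩
    exact ⟨r * s, mul_pos hr hs, by push_cast; rfl⟩
  by_cases hz : ∃ i ∈ T, |slopeForm (t i) z| < δ i * (z : ℂ).re
  · obtain ⟨i, hi, hiz⟩ := hz
    obtain ⟨r, hr, hr'⟩ := hpos (T.erase i) (Finset.erase_subset i T) fun j hj => by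
      by_contra! hj'
      exact Finset.ne_of_mem_erase hj (hdisj z j (Finset.mem_of_mem_erase hj) i hi hj' hiz)
    rw [← Finset.mul_prod_erase T _ hi, hr'] at h
    have hre := congrArg Complex.re h
    have him := congrArg Complex.im h
    simp only [crossingLoop, Complex.mul_re, Complex.mul_im, Complex.neg_re, Complex.neg_im,
      Complex.ofReal_re, Complex.ofReal_im, mul_zero, neg_zero, zero_mul, sub_zero, add_zero,
      zero_add] at hre him
    set b := δ i * (z : ℂ).re with hb
    set a := slopeForm (t i) z
    rw [max_eq_right (sub_nonneg.2 hiz.le)] at him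
    have hcr : 0 ≤ c * r := by positivity
    rcases hin z i hi hiz with ⟨ha, him0, hre0⟩ | ⟨ha, ⟨him0, hre0⟩ | hneg⟩
    · change a = 0 at ha
      rw [ha, abs_zero] at hre hiz
      have : 0 ≤ c * r * b := by positivity
      nlinarith
    · have hσi : (σ i : ℝ) ≠ 0 := by
        rcases hσ i hi with h | h <;> simp [h]
      have h1 : c * r * (σ i * (a * (b - |a|))) = 0 := by linarith
      have h2 : c * r = 0 := (mul_eq_zero.1 h1).resolve_right
        (mul_ne_zero hσi (mul_ne_zero ha (sub_pos.2 hiz).ne'))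
      have h3 : (q z).re = -(c * r) * (|a| - b / 2) := by linarith
      rw [h2] at h3
      linarith
    · change (q z).im * (σ i * a) < 0 at hneg
      have h1 : (q z).im * (σ i * a) = c * r * ((b - |a|) * (σ i * a) ^ 2) := by
        rw [him]; ring
      have h2 : 0 ≤ c * r * ((b - |a|) * (σ i * a) ^ 2) :=
        mul_nonneg hcr (mul_nonneg (sub_pos.2 hiz).le (sq_nonneg _))
      linarith
  · push Not at hz
    obtain ⟨r, hr, hr'⟩ := hpos T subset_rfl hz
    have hs := hout z hz
    rw [h, hr', Complex.mem_slitPlane_iff] at hs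
    have hcr : 0 ≤ c * r := by positivity
    rcases hs with hs | hs
    · simp at hs
      linarith
    · simp at hs

/-! ### The degree of a stabilized planar loop -/

theorem LinearMap.det_id_add_comp_comm {V W : Type*} [AddCommGroup V] [AddCommGroup W]
    [Module ℝ V] [Module ℝ W] [Module.Finite ℝ V] [Module.Finite ℝ W]
    (f : V →ₗ[ℝ] W) (g : W →ₗ[ℝ] V) :
    LinearMap.det (LinearMap.id + f ∘ₗ g) = LinearMap.det (LinearMap.id + g ∘ₗ f) := by
  classical
  let b := Module.finBasis ℝ V
  let c := Module.finBasis ℝ W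
  rw [← LinearMap.det_toMatrix c, ← LinearMap.det_toMatrix b, map_add, map_add,
    LinearMap.toMatrix_comp c b c, LinearMap.toMatrix_comp b c b, LinearMap.toMatrix_id,
    LinearMap.toMatrix_id, Matrix.det_one_add_mul_comm]

/-- An orthonormal pair of vectors of `ℝ^d` spans a copy of the plane, and there is a projection
onto it. -/
theorem exists_plane_embedding {d : ℕ} (hd : 2 ≤ d) :
    ∃ (ι : ℂ →ₗᵢ[ℝ] Euc d) (π : Euc d →L[ℝ] ℂ), ∀ z, π (ι z) = z := by
  let i : Fin d := ⟨0, by omega⟩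
  let j : Fin d := ⟨1, by omega⟩
  have hij : i ≠ j := by simp [i, j]
  let π : Euc d →L[ℝ] ℂ := Complex.ofRealCLM.comp (EuclideanSpace.proj i) +
    Complex.I • Complex.ofRealCLM.comp (EuclideanSpace.proj j)
  let ι : ℂ →L[ℝ] Euc d := Complex.reCLM.smulRight (EuclideanSpace.single i (1 : ℝ)) +
    Complex.imCLM.smulRight (EuclideanSpace.single j (1 : ℝ))
  have hι : ∀ z, ι z = z.re • EuclideanSpace.single i (1 : ℝ) +
      z.im • EuclideanSpace.single j (1 : ℝ) := fun z => rfl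
  refine ⟨⟨ι.toLinearMap, fun z => ?_⟩, π, fun z => ?_⟩
  · rw [← sq_eq_sq₀ (norm_nonneg _) (norm_nonneg _), ← Complex.normSq_eq_norm_sq,
      Complex.normSq_apply]
    change ‖ι z‖ ^ 2 = _
    rw [hι, @norm_add_sq ℝ]
    simp [inner_smul_left, inner_smul_right, norm_smul, EuclideanSpace.inner_single_left,
      hij, sq]
  · change π (ι z) = z
    apply Complex.ext <;> simp [π, hι, hij, hij.symm]

/-- The direction of a nonzero complex number. -/
noncomputable def direction (z : ℂ) : Circle := Circle.exp z.arg

theorem norm_mul_direction (z : ℂ) : (‖z‖ : ℂ) * direction z = z := by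
  rw [direction, Circle.coe_exp, Complex.norm_mul_exp_arg_mul_I]

theorem continuousAt_direction {z : ℂ} (hz : z ≠ 0) : ContinuousAt direction z := by
  have hind : Topology.IsInducing ((↑) : Circle → ℂ) := Topology.IsInducing.subtypeVal
  refine hind.continuousAt_iff.2 ?_
  have h : ContinuousAt (fun w : ℂ => w / ‖w‖) z :=
    continuousAt_id.div (Complex.continuous_ofReal.comp continuous_norm).continuousAt
      (by simpa using hz)
  refine h.congr ?_
  filter_upwards [isOpen_ne.mem_nhds hz] with w hw
  have : (‖w‖ : ℂ) ≠ 0 := by simpa using hw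
  change w / ‖w‖ = (direction w : ℂ)
  rw [div_eq_iff this, mul_comm, norm_mul_direction]

/-- The positively homogeneous extension to the plane of a homotopy of loops. -/
theorem continuous_norm_mul_direction (h : C(unitInterval × Circle, ℂ)) :
    Continuous fun x : unitInterval × ℂ => (‖x.2‖ : ℂ) * h (x.1, direction x.2) := by
  rw [continuous_iff_continuousAt]
  rintro ⟨s, z⟩
  by_cases hz : z = 0
  · subst hz
    rw [ContinuousAt, norm_zero, Complex.ofReal_zero, zero_mul]
    refine squeeze_zero_norm (a := fun x : unitInterval × ℂ => ‖x.2‖ * ‖h‖) (fun x => ?_) ?_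
    · rw [norm_mul, Complex.norm_real, norm_norm]
      exact mul_le_mul_of_nonneg_left (h.norm_coe_le_norm _) (norm_nonneg _)
    · have : Continuous fun x : unitInterval × ℂ => ‖x.2‖ * ‖h‖ := by fun_prop
      simpa using this.tendsto (s, 0)
  · have h1 : ContinuousAt (fun x : unitInterval × ℂ => (x.1, direction x.2)) (s, z) :=
      continuousAt_fst.prodMk
        (ContinuousAt.comp (f := Prod.snd) (g := direction) (continuousAt_direction hz)
          continuousAt_snd)
    have h2 : ContinuousAt (fun x : unitInterval × ℂ => (‖x.2‖ : ℂ)) (s, z) := by fun_prop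
    exact h2.mul (h.continuous.continuousAt.comp h1)

section Stabilization

variable {d : ℕ} (ι : ℂ →ₗᵢ[ℝ] Euc d) (π : Euc d →L[ℝ] ℂ)

/-- The map of `ℝ^d` that is `w` on a plane and the identity in the complementary directions. -/
noncomputable def stabilize (w : ℂ → ℂ) (x : Euc d) : Euc d := x - ι (π x) + ι (w (π x))

variable {ι π}

theorem eq_of_stabilize_eq_zero (hπ : ∀ z, π (ι z) = z) {w : ℂ → ℂ} {x : Euc d}
    (h : stabilize ι π w x = 0) : w (π x) = 0 ∧ x = ι (π x) := by
  have h1 : w (π x) = 0 := by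
    have := congrArg π h
    simpa [stabilize, hπ] using this
  refine ⟨h1, ?_⟩
  rwa [stabilize, h1, map_zero, add_zero, sub_eq_zero] at h

theorem stabilize_ne_zero (hπ : ∀ z, π (ι z) = z) {w : ℂ → ℂ} {r : ℝ}
    (hw : ∀ z : ℂ, ‖z‖ = r → w z ≠ 0) (x : Metric.sphere (0 : Euc d) r) :
    stabilize ι π w x ≠ 0 := by
  intro h
  obtain ⟨h1, h2⟩ := eq_of_stabilize_eq_zero hπ h
  refine hw _ ?_ h1
  rw [← ι.norm_map, ← h2]
  exact mem_sphere_zero_iff_norm.1 x.2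

end Stabilization

/-- The map `x ↦ v x / ‖v x‖` to the unit sphere. -/
noncomputable def normalizedMap {d : ℕ} {X : Type*} [TopologicalSpace X] (v : X → Euc d)
    (hv : Continuous v) (hv0 : ∀ x, v x ≠ 0) : C(X, Metric.sphere (0 : Euc d) 1) where
  toFun x := ⟨‖v x‖⁻¹ • v x, by
    rw [mem_sphere_zero_iff_norm, norm_smul, norm_inv, norm_norm,
      inv_mul_cancel₀ (norm_ne_zero_iff.2 (hv0 x))]⟩
  continuous_toFun := by
    refine Continuous.subtype_mk ?_ _
    exact (hv.norm.inv₀ fun x => norm_ne_zero_iff.2 (hv0 x)).smul hv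

theorem normalizedMap_homotopic {d : ℕ} {X : Type*} [TopologicalSpace X]
    {F : unitInterval × X → Euc d} (hF : Continuous F) (hF0 : ∀ x, F x ≠ 0) {v w : X → Euc d}
    (hv : Continuous v) (hv0 : ∀ x, v x ≠ 0) (hw : Continuous w) (hw0 : ∀ x, w x ≠ 0)
    (h0 : ∀ x, F (0, x) = v x) (h1 : ∀ x, F (1, x) = w x) :
    (normalizedMap v hv hv0).Homotopic (normalizedMap w hw hw0) :=
  ⟨{ toContinuousMap := normalizedMap F hF hF0
     map_zero_left := fun x => by
       apply Subtype.ext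
       change ‖F (0, x)‖⁻¹ • F (0, x) = _
       rw [h0]; rfl
     map_one_left := fun x => by
       apply Subtype.ext
       change ‖F (1, x)‖⁻¹ • F (1, x) = _
       rw [h1]; rfl }⟩

/-- A smooth planar map with nondegenerate zeros, of degree `k` if the isometry `κ` is the identity
and of degree `-k` if `κ` is the complex conjugation. -/
noncomputable def degreeModel (κ : ℂ ≃ₗᵢ[ℝ] ℂ) (k : ℕ) (ε : ℝ) (z : ℂ) : ℂ := κ (z ^ k - ε)

theorem det_fderiv_stabilize_degreeModel {d : ℕ} {ι : ℂ →ₗᵢ[ℝ] Euc d} {π : Euc d →L[ℝ] ℂ}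
    (hπ : ∀ z, π (ι z) = z) (κ : ℂ ≃ₗᵢ[ℝ] ℂ) (k : ℕ) (ε : ℝ) (x : Euc d) :
    (fderiv ℝ (stabilize ι π (degreeModel κ k ε)) x).det =
      LinearMap.det (κ.toLinearEquiv : ℂ →ₗ[ℝ] ℂ) * Complex.normSq (k * (π x) ^ (k - 1)) := by
  set c : ℂ := k * (π x) ^ (k - 1) with hc
  have hP : HasFDerivAt (fun z : ℂ => z ^ k - (ε : ℂ))
      ((ContinuousLinearMap.toSpanSingleton ℂ c).restrictScalars ℝ) (π x) := by
    have := ((hasDerivAt_pow k (π x)).sub_const (ε : ℂ)).hasFDerivAt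
    exact this.restrictScalars ℝ
  have hκ := (κ.toContinuousLinearEquiv : ℂ →L[ℝ] ℂ).hasFDerivAt.comp (π x) hP
  have hG := ((hasFDerivAt_id x).sub (ι.toContinuousLinearMap.comp π).hasFDerivAt).add
    (ι.toContinuousLinearMap.hasFDerivAt.comp x (hκ.comp x π.hasFDerivAt))
  have hG' : HasFDerivAt (stabilize ι π (degreeModel κ k ε)) _ x := hG
  rw [hG'.fderiv, ContinuousLinearMap.det]
  set B : ℂ →ₗ[ℝ] ℂ := (κ.toLinearEquiv : ℂ →ₗ[ℝ] ℂ) ∘ₗ Algebra.lmul ℝ ℂ c with hB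
  have h1 : ∀ A : Euc d →L[ℝ] Euc d, (∀ y, A y = y + ι (B (π y) - π y)) →
      LinearMap.det (A : Euc d →ₗ[ℝ] Euc d) = LinearMap.det B := by
    intro A hA
    have e1 : (A : Euc d →ₗ[ℝ] Euc d) =
        LinearMap.id + ι.toLinearMap ∘ₗ ((B - LinearMap.id) ∘ₗ π.toLinearMap) := by
      ext1 y
      simpa using hA y
    have e2 : LinearMap.id + ((B - LinearMap.id) ∘ₗ π.toLinearMap) ∘ₗ ι.toLinearMap = B := by
      ext1 z
      simp [hπ]
    rw [e1, LinearMap.det_id_add_comp_comm, e2]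
  rw [h1 _ fun y => ?_, hB, LinearMap.det_comp]
  · congr 1
    exact (Algebra.norm_apply ℝ c).symm.trans (Algebra.norm_complex_apply c)
  · simp [hB, mul_comm c]
    abel

theorem contDiff_stabilize_degreeModel {d : ℕ} (ι : ℂ →ₗᵢ[ℝ] Euc d) (π : Euc d →L[ℝ] ℂ)
    (κ : ℂ ≃ₗᵢ[ℝ] ℂ) (k : ℕ) (ε : ℝ) :
    ContDiff ℝ ∞ (stabilize ι π (degreeModel κ k ε)) := by
  have h1 : ContDiff ℝ ∞ fun x : Euc d => (π x) ^ k - (ε : ℂ) :=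
    (π.contDiff.pow k).sub contDiff_const
  have h2 : ContDiff ℝ ∞ fun x : Euc d => ι (κ ((π x) ^ k - (ε : ℂ))) :=
    ι.contDiff.comp (κ.contDiff.comp h1)
  exact (contDiff_id.sub (ι.contDiff.comp π.contDiff)).add h2

theorem exists_finset_pow_eq {ε : ℝ} (k : ℕ) (hε : 0 < ε) (hk : k = 0 → ε ≠ 1) :
    ∃ R : Finset ℂ, R.card = k ∧ ∀ z, z ∈ R ↔ z ^ k = ε := by
  rcases Nat.eq_zero_or_pos k with rfl | hk0
  · refine ⟨∅, rfl, fun z => ?_⟩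
    have : (1 : ℂ) ≠ ε := fun h => hk rfl (by exact_mod_cast h.symm)
    simpa using this
  · have hε' : (ε : ℂ) ≠ 0 := by exact_mod_cast hε.ne'
    have hk' : (k : ℂ) ≠ 0 := by exact_mod_cast hk0.ne'
    refine ⟨(Polynomial.nthRoots k (ε : ℂ)).toFinset, ?_, fun z => ?_⟩
    · have hsep := Polynomial.nodup_roots (Polynomial.separable_X_pow_sub_C (ε : ℂ) hk' hε')
      rw [Multiset.toFinset_card_of_nodup (m := Polynomial.nthRoots k (ε : ℂ)) hsep]
      change (Polynomial.X ^ k - Polynomial.C (ε : ℂ)).roots.card = k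
      rw [← (IsAlgClosed.splits _).natDegree_eq_card_roots, Polynomial.natDegree_X_pow_sub_C]
    · rw [Multiset.mem_toFinset, Polynomial.mem_nthRoots hk0]

theorem hasSignedZeroCount_stabilize {d : ℕ} {ι : ℂ →ₗᵢ[ℝ] Euc d} {π : Euc d →L[ℝ] ℂ}
    (hπ : ∀ z, π (ι z) = z) (κ : ℂ ≃ₗᵢ[ℝ] ℂ) {τ : SignType} (hτ : τ ≠ 0)
    (hκ : LinearMap.det (κ.toLinearEquiv : ℂ →ₗ[ℝ] ℂ) = (τ : ℝ)) (k : ℕ) {r ε : ℝ}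
    (hr : 0 < r) (hε : 0 < ε) (hεr : ε < r ^ k) :
    HasSignedZeroCount (stabilize ι π (degreeModel κ k ε)) 0 r (τ * k) := by
  classical
  have hε1 : k = 0 → ε ≠ 1 := by
    rintro rfl
    simpa using hεr.ne
  have hzero : ∀ x, stabilize ι π (degreeModel κ k ε) x = 0 ↔ ∃ z : ℂ, z ^ k = ε ∧ ι z = x := by
    intro x
    constructor
    · intro h
      obtain ⟨h1, h2⟩ := eq_of_stabilize_eq_zero hπ h
      refine ⟨π x, ?_, h2.symm⟩
      rwa [degreeModel, LinearIsometryEquiv.map_eq_zero_iff, sub_eq_zero] at h1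
    · rintro ⟨z, hz, rfl⟩
      simp [stabilize, degreeModel, hπ, hz]
  have hsign : ∀ x, stabilize ι π (degreeModel κ k ε) x = 0 →
      SignType.sign (fderiv ℝ (stabilize ι π (degreeModel κ k ε)) x).det = τ := by
    intro x hx
    obtain ⟨z, hz, rfl⟩ := (hzero x).1 hx
    have hk : k ≠ 0 := by
      rintro rfl
      rw [pow_zero] at hz
      exact hε1 rfl (by exact_mod_cast hz.symm)
    have hz0 : z ≠ 0 := by
      rintro rfl
      rw [zero_pow hk] at hz
      exact hε.ne (by exact_mod_cast hz)
    have hpos : 0 < Complex.normSq (k * (π (ι z)) ^ (k - 1)) := by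
      rw [hπ, Complex.normSq_pos]
      exact mul_ne_zero (by exact_mod_cast hk) (pow_ne_zero _ hz0)
    rw [det_fderiv_stabilize_degreeModel hπ, hκ, sign_mul, sign_pos hpos, mul_one]
    revert hτ
    cases τ <;> simp
  obtain ⟨R, hRk, hR⟩ := exists_finset_pow_eq k hε hε1
  refine ⟨fun x _ hx h => hτ ?_, R.map ⟨ι, ι.injective⟩, fun x => ?_, ?_⟩
  · rw [← hsign x hx, h, sign_zero]
  · rw [hzero, Finset.mem_map]
    constructor
    · rintro ⟨z, hz, rfl⟩
      have hz' := (hR z).1 hz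
      refine ⟨?_, z, hz', rfl⟩
      rw [mem_ball_zero_iff]
      change ‖ι z‖ < r
      rw [ι.norm_map]
      refine lt_of_pow_lt_pow_left₀ k hr.le ?_
      rw [← norm_pow, hz', Complex.norm_real, Real.norm_of_nonneg hε.le]
      exact hεr
    · rintro ⟨-, z, hz, rfl⟩
      exact ⟨z, (hR z).2 hz, rfl⟩
  · rw [Finset.sum_map, Finset.sum_congr rfl fun z hz => ?_, Finset.sum_const, hRk, nsmul_eq_mul,
      mul_comm]
    exact congrArg _ (hsign _ ((hzero _).2 ⟨z, (hR z).1 hz, rfl⟩))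

theorem exists_isometry_zpow (m : ℤ) : ∃ (κ : ℂ ≃ₗᵢ[ℝ] ℂ) (τ : SignType), τ ≠ 0 ∧
    LinearMap.det (κ.toLinearEquiv : ℂ →ₗ[ℝ] ℂ) = (τ : ℝ) ∧ (τ : ℤ) * m.natAbs = m ∧
    (∀ a : ℝ, κ a = a) ∧ ∀ z : Circle, κ ((z : ℂ) ^ m.natAbs) = (z : ℂ) ^ m := by
  rcases le_total 0 m with hm | hm
  · refine ⟨LinearIsometryEquiv.refl ℝ ℂ, 1, one_ne_zero, ?_, ?_, fun a => rfl, fun z => ?_⟩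
    · simp
    · simp [abs_of_nonneg hm]
    · change (z : ℂ) ^ m.natAbs = _
      rw [← zpow_natCast, Int.natAbs_of_nonneg hm]
  · refine ⟨Complex.conjLIE, -1, by decide, ?_, ?_, fun a => ?_, fun z => ?_⟩
    · rw [Complex.det_conjLIE]; simp
    · simp [abs_of_nonpos hm]
    · simp
    · rw [Complex.conjLIE_apply, map_pow, ← Circle.coe_inv_eq_conj, Circle.coe_inv, inv_pow,
        ← zpow_natCast, ← zpow_neg, Int.ofNat_natAbs_of_nonpos hm, neg_neg]

/-- If a planar map `g` is positively homogeneous and has only the fixed point `0`, then the index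
of its extension to `ℝ^d` (by a constant map in the complementary directions) is the winding number
of `z - g z` along the unit circle. The homotopy first contracts the logarithm of
`(z - g z) / z ^ m`, and then moves `|z| (z / |z|) ^ m` to a smooth model on a straight line. -/
theorem hasFixedPointIndex_of_hasWinding {d : ℕ} {ι : ℂ →ₗᵢ[ℝ] Euc d} {π : Euc d →L[ℝ] ℂ}
    (hπ : ∀ z, π (ι z) = z) {g : ℂ → ℂ} (hg : Continuous g)
    (hom : ∀ (r : ℝ) (z : ℂ), 0 ≤ r → g (r * z) = r * g z) (hfix : ∀ z, g z = z → z = 0) {m : ℤ}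
    (hw : HasWinding (fun z => z - g z) m) :
    HasFixedPointIndex (fun x => ι (g (π x))) 0 m := by
  obtain ⟨L, hL⟩ := hw
  obtain ⟨κ, τ, hτ, hκdet, hτm, hκreal, hκpow⟩ := exists_isometry_zpow m
  have hfp : Function.fixedPoints (fun x => ι (g (π x))) = {0} := by
    ext x
    simp only [Function.mem_fixedPoints, Function.IsFixedPt, Set.mem_singleton_iff]
    constructor
    · intro h
      have h1 : π x = 0 := hfix _ (by rw [← hπ (g (π x)), h])
      have h0 : g 0 = 0 := by simpa using hom 0 0 le_rfl
      rw [← h, h1, h0, map_zero]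
    · rintro rfl
      have h0 : g 0 = 0 := by simpa using hom 0 0 le_rfl
      simp [h0]
  refine ⟨⟨1, one_pos, ?_⟩, ?_⟩
  · rw [hfp]
    ext x
    constructor
    · exact fun h => h.1
    · rintro rfl
      exact ⟨rfl, Metric.mem_closedBall_self zero_le_one⟩
  rintro r ⟨hr, -⟩
  set k := m.natAbs
  set ε : ℝ := r ^ k / 2
  have hrk : 0 < r ^ k := pow_pos hr k
  -- the three planar maps that are the ends of the two homotopies
  let w₀ : ℂ → ℂ := fun z => z - g z
  let w₁ : ℂ → ℂ := fun z => ‖z‖ * (direction z : ℂ) ^ m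
  let w₂ : ℂ → ℂ := degreeModel κ k ε
  have hw₂ : Continuous w₂ := by
    change Continuous fun z => κ (z ^ k - (ε : ℂ))
    exact κ.continuous.comp (by fun_prop)
  have hzpow : Continuous fun z : Circle => (z : ℂ) ^ m := by
    have hpow : Continuous fun z : Circle => z ^ m := continuous_zpow m
    exact hpow.subtype_val
  let h : C(unitInterval × Circle, ℂ) :=
    ⟨fun x => (x.2 : ℂ) ^ m * Complex.exp (((1 - x.1 : ℝ) : ℂ) * L x.2),
      (hzpow.comp continuous_snd).mul (by fun_prop)⟩
  let H₁ : unitInterval × ℂ → ℂ := fun x => ‖x.2‖ * h (x.1, direction x.2)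
  have hH₁ : Continuous H₁ := continuous_norm_mul_direction h
  have hw₁ : Continuous w₁ := by
    have : w₁ = fun z => H₁ (1, z) := by
      ext z
      simp [w₁, H₁, h]
    rw [this]
    exact hH₁.comp (by fun_prop)
  let H₂ : unitInterval × ℂ → ℂ := fun x => ((1 - x.1 : ℝ) : ℂ) * w₁ x.2 + ((x.1 : ℝ) : ℂ) * w₂ x.2
  have hH₂ : Continuous H₂ := by
    have h1 : Continuous fun x : unitInterval × ℂ => w₁ x.2 := hw₁.comp continuous_snd
    have h2 : Continuous fun x : unitInterval × ℂ => w₂ x.2 := hw₂.comp continuous_snd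
    have h3 : Continuous fun x : unitInterval × ℂ => (((x.1 : ℝ) : ℂ)) :=
      Complex.continuous_ofReal.comp (continuous_subtype_val.comp continuous_fst)
    have h4 : Continuous fun x : unitInterval × ℂ => (((1 - x.1 : ℝ) : ℂ)) := by
      push_cast
      exact continuous_const.sub h3
    exact (h4.mul h1).add (h3.mul h2)
  have hH₁0 : ∀ s z, ‖z‖ = r → H₁ (s, z) ≠ 0 := by
    intro s z hz
    refine mul_ne_zero ?_ (mul_ne_zero (zpow_ne_zero _ (Circle.coe_ne_zero _))
      (Complex.exp_ne_zero _))
    rw [hz]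
    exact_mod_cast hr.ne'
  have hH₂0 : ∀ s z, ‖z‖ = r → H₂ (s, z) ≠ 0 := by
    intro s z hz h0
    have hs0 : 0 ≤ (s : ℝ) := s.2.1
    have hs1 : (s : ℝ) ≤ 1 := s.2.2
    have e1 : w₂ z = ((r ^ k : ℝ) : ℂ) * (direction z : ℂ) ^ m - ε := by
      have hzk : z ^ k = (r ^ k : ℝ) • (direction z : ℂ) ^ k := by
        conv_lhs => rw [← norm_mul_direction z, hz, mul_pow]
        rw [Complex.real_smul]
        push_cast
        rfl
      simp only [w₂, degreeModel, map_sub, hκreal]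
      rw [hzk, LinearIsometryEquiv.map_smul, hκpow, Complex.real_smul]
    have e2 : (((1 - s) * r + s * r ^ k : ℝ) : ℂ) * (direction z : ℂ) ^ m = ((s * ε : ℝ) : ℂ) := by
      simp only [H₂, w₁, e1, hz] at h0
      push_cast at h0 ⊢
      linear_combination h0
    have e3 : (1 - s) * r + s * r ^ k = s * ε := by
      have := congrArg norm e2
      rw [norm_mul, norm_zpow, Circle.norm_coe, one_zpow, mul_one, Complex.norm_real,
        Complex.norm_real, Real.norm_of_nonneg (by
          have := mul_nonneg (sub_nonneg.2 hs1) hr.le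
          positivity), Real.norm_of_nonneg (by positivity)] at this
      exact this
    have e4 : (1 - s) * r + s * (r ^ k / 2) = 0 := by
      simp only [ε] at e3
      linarith
    have h5 : 0 ≤ (1 - (s : ℝ)) * r := mul_nonneg (sub_nonneg.2 hs1) hr.le
    rcases hs0.eq_or_lt with h6 | h6
    · rw [← h6] at e4
      linarith
    · have : 0 < s * (r ^ k / 2) := by positivity
      linarith
  have hstart : ∀ z, H₁ (0, z) = w₀ z := by
    intro z
    have h1 : w₀ z = ‖z‖ * w₀ (direction z) := by
      simp only [w₀]
      rw [mul_sub, ← hom _ _ (norm_nonneg z), norm_mul_direction]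
    rw [h1]
    simp [H₁, h, w₀, hL]
  have hmid : ∀ z, H₁ (1, z) = w₁ z := fun z => by simp [H₁, h, w₁]
  have hmid' : ∀ z, H₂ (0, z) = w₁ z := fun z => by simp [H₂]
  have hend : ∀ z, H₂ (1, z) = w₂ z := fun z => by simp [H₂]
  have hne : ∀ {w : ℂ → ℂ}, (∀ z, ‖z‖ = r → w z ≠ 0) → ∀ x : Metric.sphere (0 : Euc d) r,
      stabilize ι π w x ≠ 0 := fun hw x => stabilize_ne_zero hπ hw x
  have hct : ∀ {w : ℂ → ℂ}, Continuous w →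
      Continuous fun x : Metric.sphere (0 : Euc d) r => stabilize ι π w x := by
    intro w hw
    unfold stabilize
    have := ι.continuous
    fun_prop
  have hct' : ∀ {H : unitInterval × ℂ → ℂ}, Continuous H → Continuous
      fun x : unitInterval × Metric.sphere (0 : Euc d) r =>
        stabilize ι π (fun z => H (x.1, z)) x.2 := by
    intro H hH
    unfold stabilize
    have := ι.continuous
    fun_prop
  have c₀ : Continuous w₀ := continuous_id.sub hg
  have n₀ : ∀ z, ‖z‖ = r → w₀ z ≠ 0 := fun z hz => hstart z ▸ hH₁0 0 z hz
  have n₁ : ∀ z, ‖z‖ = r → w₁ z ≠ 0 := fun z hz => hmid z ▸ hH₁0 1 z hz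
  have n₂ : ∀ z, ‖z‖ = r → w₂ z ≠ 0 := fun z hz => hend z ▸ hH₂0 1 z hz
  have hom₁ := normalizedMap_homotopic (hct' hH₁) (fun x => hne (hH₁0 x.1) x.2) (hct c₀) (hne n₀)
    (hct hw₁) (hne n₁) (fun x => by simp only [hstart]) (fun x => by simp only [hmid])
  have hom₂ := normalizedMap_homotopic (hct' hH₂) (fun x => hne (hH₂0 x.1) x.2) (hct hw₁) (hne n₁)
    (hct hw₂) (hne n₂) (fun x => by simp only [hmid']) (fun x => by simp only [hend])
  refine ⟨_, fun x => ?_, stabilize ι π w₂, contDiff_stabilize_degreeModel ι π κ k ε,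
    ⟨_, fun x => rfl, hom₁.trans hom₂⟩, ?_⟩
  · have : stabilize ι π w₀ x = x - ι (g (π x)) := by
      simp [stabilize, w₀]
    change ‖stabilize ι π w₀ x‖⁻¹ • stabilize ι π w₀ x = _
    rw [this]
  · have := hasSignedZeroCount_stabilize hπ κ hτ hκdet k hr (half_pos hrk) (half_lt_self hrk)
    rwa [hτm] at this

/-! ### The planar map -/

/-- The midpoint of the `p`-th of a sequence of disjoint intervals in `(3/4, 1)`. -/
noncomputable def bumpCenter (p : ℕ) : ℝ := 1 - (1 / 2) ^ (p + 3)

/-- The half-length of the `p`-th interval. -/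
noncomputable def bumpRadius (p : ℕ) : ℝ := (1 / 2) ^ (p + 5)

theorem bumpRadius_pos (p : ℕ) : 0 < bumpRadius p := by
  unfold bumpRadius; positivity

theorem bumpCenter_sub (p : ℕ) : 3 / 4 < bumpCenter p - 2 * bumpRadius p := by
  have h : ((1 : ℝ) / 2) ^ p ≤ 1 := pow_le_one₀ (by norm_num) (by norm_num)
  rw [bumpCenter, bumpRadius, pow_add, pow_add]
  norm_num
  norm_num at h
  linarith

theorem bumpCenter_add (p : ℕ) : bumpCenter p + 2 * bumpRadius p < 1 := by
  have h : (0 : ℝ) < (1 / 2) ^ p := by positivity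
  rw [bumpCenter, bumpRadius, pow_add, pow_add]
  linarith

theorem mem_Ioo_of_abs_sub_bumpCenter_lt {p : ℕ} {t : ℝ}
    (h : |t - bumpCenter p| < 2 * bumpRadius p) : 3 / 4 < t ∧ t < 1 := by
  have h1 := bumpCenter_sub p
  have h2 := bumpCenter_add p
  rw [abs_lt] at h
  constructor <;> linarith

theorem bump_disjoint {p q : ℕ} {t : ℝ} (hp : |t - bumpCenter p| < bumpRadius p)
    (hq : |t - bumpCenter q| < bumpRadius q) : p = q := by
  wlog hpq : p < q generalizing p q
  · rcases eq_or_lt_of_not_gt hpq with h | h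
    · exact h.symm
    · exact (this hq hp h).symm
  exfalso
  have h : ((1 : ℝ) / 2) ^ q ≤ (1 / 2) ^ (p + 1) :=
    pow_le_pow_of_le_one (by norm_num) (by norm_num) hpq
  have h0 : (0 : ℝ) < (1 / 2) ^ p := by positivity
  rw [abs_lt] at hp hq
  rw [pow_succ] at h
  simp only [bumpCenter, bumpRadius, pow_add] at hp hq
  norm_num at hp hq h h0
  linarith

/-- A tent of height `1` over the `p`-th interval, supported by its middle half. -/
noncomputable def tent (p : ℕ) (t : ℝ) : ℝ := max 0 (1 - 2 * |t - bumpCenter p| / bumpRadius p)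

theorem tent_nonneg (p : ℕ) (t : ℝ) : 0 ≤ tent p t := le_max_left _ _

theorem tent_bumpCenter (p : ℕ) : tent p (bumpCenter p) = 1 := by simp [tent]

theorem tent_le_one (p : ℕ) (t : ℝ) : tent p t ≤ 1 := by
  have h : 0 ≤ 2 * |t - bumpCenter p| / bumpRadius p :=
    div_nonneg (by positivity) (bumpRadius_pos p).le
  exact max_le zero_le_one (by linarith)

theorem abs_sub_lt_of_tent_ne_zero {p : ℕ} {t : ℝ} (h : tent p t ≠ 0) :
    2 * |t - bumpCenter p| < bumpRadius p := by
  by_contra! h'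
  refine h (max_eq_left ?_)
  rw [sub_nonpos, le_div_iff₀ (bumpRadius_pos p), one_mul]
  exact h'

/-- The point `1 + t i` of the vertical line through `1`, on the ray of slope `t`. -/
noncomputable def slopePoint (t : ℝ) : ℂ := 1 + t * Complex.I

/-- The stretching factor of the drift. -/
noncomputable def driftFactor (t : ℝ) : ℝ := 2 * max 0 (min 1 (5 - 8 * |t|))

/-- The slope multiplier of the return map to a bump with a prescribed sign: the return map is
expanding for a positive sign and constant for a negative one. -/
def returnMultiplier (a : ℤ) : ℝ := if 0 < a then 2 else 0

/-- The values at `1 + t i` of the jump from the `p`-th bump: the ray of slope `t` is mapped to the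
ray of slope `2 ^ (-k) * R t`, with `R` the affine map that fixes the centre of the bump and has
slope `m`. -/
noncomputable def jump (k p : ℕ) (m t : ℝ) : ℂ :=
  ((2 * (1 / 2) ^ k * tent p t : ℝ) : ℂ) *
    slopePoint ((1 / 2) ^ k * (bumpCenter p + m * (t - bumpCenter p)))

/-- The values of the planar map on the line of the points `1 + t i`. The drift doubles the slopes,
and for each `k` there are `|b k|` bumps from which the map jumps to the rays that return to the
bump after `k` steps of the drift. -/
noncomputable def profile (b : ℕ → ℤ) (t : ℝ) : ℂ :=
  driftFactor t * slopePoint (2 * t) +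
    ∑' k, ∑ i ∈ Finset.range (b k).natAbs, jump k (Nat.pair k i) (returnMultiplier (b k)) t

/-- The planar map: it is positively homogeneous, maps the left half-plane to `0`, and is given by
the profile on the line of the points `1 + t i`. -/
noncomputable def planarMap (b : ℕ → ℤ) (z : ℂ) : ℂ := (max z.re 0 : ℝ) * profile b (z.im / z.re)

theorem continuous_slopePoint : Continuous slopePoint := by
  unfold slopePoint; fun_prop

theorem continuous_jump (k p : ℕ) (m : ℝ) : Continuous (jump k p m) := by
  have h : Continuous (tent p) := by unfold tent; fun_prop
  have := continuous_slopePoint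
  unfold jump
  fun_prop

theorem returnMultiplier_mem (a : ℤ) : returnMultiplier a = 0 ∨ returnMultiplier a = 2 := by
  unfold returnMultiplier
  split_ifs <;> simp

theorem abs_returnMultiplier_mul_lt {a : ℤ} {x r : ℝ} (hr : 0 < r) (h : 2 * |x| < r) :
    |returnMultiplier a * x| < r := by
  rcases returnMultiplier_mem a with h' | h' <;> rw [h']
  · simpa using hr
  · rwa [abs_mul, abs_two]

theorem jump_eq_zero {k p : ℕ} {m t : ℝ} (h : ¬ 2 * |t - bumpCenter p| < bumpRadius p) :
    jump k p m t = 0 := by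
  have : tent p t = 0 := by
    by_contra h'
    exact h (abs_sub_lt_of_tent_ne_zero h')
  simp [jump, this]

theorem norm_jump_le (k p : ℕ) (a : ℤ) (t : ℝ) :
    ‖jump k p (returnMultiplier a) t‖ ≤ 4 * (1 / 2) ^ k := by
  by_cases h : 2 * |t - bumpCenter p| < bumpRadius p
  · have h1 := mem_Ioo_of_abs_sub_bumpCenter_lt (p := p)
      (t := bumpCenter p + returnMultiplier a * (t - bumpCenter p)) (by
        rw [add_sub_cancel_left]
        have := abs_returnMultiplier_mul_lt (a := a) (bumpRadius_pos p) h
        linarith [bumpRadius_pos p])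
    have hk0 : (0 : ℝ) < (1 / 2) ^ k := by positivity
    have hk : ((1 : ℝ) / 2) ^ k ≤ 1 := pow_le_one₀ (by norm_num) (by norm_num)
    have h2 : ‖slopePoint ((1 / 2) ^ k *
        (bumpCenter p + returnMultiplier a * (t - bumpCenter p)))‖ ≤ 2 := by
      rw [slopePoint]
      refine (norm_add_le _ _).trans ?_
      rw [norm_mul, Complex.norm_I, mul_one, Complex.norm_real, norm_one, Real.norm_eq_abs,
        abs_mul, abs_of_pos hk0, abs_of_pos (by linarith : 0 < bumpCenter p +
          returnMultiplier a * (t - bumpCenter p))]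
      nlinarith
    rw [jump, norm_mul, Complex.norm_real, Real.norm_of_nonneg
      (mul_nonneg (by positivity) (tent_nonneg p t))]
    have h3 : 2 * (1 / 2) ^ k * tent p t ≤ 2 * (1 / 2) ^ k :=
      mul_le_of_le_one_right (by positivity) (tent_le_one p t)
    calc _ ≤ 2 * (1 / 2) ^ k * 2 := mul_le_mul h3 h2 (norm_nonneg _) (by positivity)
      _ = _ := by ring
  · rw [jump_eq_zero h, norm_zero]
    positivity

section Profile

variable {b : ℕ → ℤ}

/-- The jumps of the same period have disjoint supports, hence their sum has the bound of a single
jump, whatever their number is. -/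
theorem norm_sum_jump_le (k : ℕ) (t : ℝ) :
    ‖∑ i ∈ Finset.range (b k).natAbs, jump k (Nat.pair k i) (returnMultiplier (b k)) t‖ ≤
      4 * (1 / 2) ^ k := by
  by_cases h : ∃ i ∈ Finset.range (b k).natAbs,
      2 * |t - bumpCenter (Nat.pair k i)| < bumpRadius (Nat.pair k i)
  · obtain ⟨i, hi, hit⟩ := h
    rw [Finset.sum_eq_single_of_mem i hi]
    · exact norm_jump_le _ _ _ _
    · intro j _ hji
      refine jump_eq_zero fun hjt => hji ?_
      have := bump_disjoint (by linarith [abs_nonneg (t - bumpCenter (Nat.pair k j))])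
        (by linarith [abs_nonneg (t - bumpCenter (Nat.pair k i))] :
          |t - bumpCenter (Nat.pair k i)| < bumpRadius (Nat.pair k i)) (t := t) (p := Nat.pair k j)
      exact (Nat.pair_eq_pair.1 this).2
  · push Not at h
    rw [Finset.sum_eq_zero fun i hi => jump_eq_zero (h i hi).not_gt, norm_zero]
    positivity

theorem continuous_profile : Continuous (profile b) := by
  have h1 : Continuous driftFactor := by unfold driftFactor; fun_prop
  have h2 := continuous_slopePoint
  unfold profile
  refine Continuous.add (by fun_prop) (continuous_tsum (fun k => ?_)
    (summable_geometric_two.mul_left 4) fun k t => norm_sum_jump_le k t)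
  exact continuous_finsetSum _ fun i _ => continuous_jump _ _ _

theorem profile_eq_drift {t : ℝ} (h : ∀ k, ∀ i < (b k).natAbs,
    bumpRadius (Nat.pair k i) ≤ |t - bumpCenter (Nat.pair k i)|) :
    profile b t = driftFactor t * slopePoint (2 * t) := by
  rw [profile, add_eq_left]
  convert tsum_zero with k
  refine Finset.sum_eq_zero fun i hi => jump_eq_zero ?_
  have := h k i (Finset.mem_range.1 hi)
  have h0 := abs_nonneg (t - bumpCenter (Nat.pair k i))
  linarith

theorem driftFactor_nonneg (t : ℝ) : 0 ≤ driftFactor t :=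
  mul_nonneg zero_le_two (le_max_left _ _)

theorem driftFactor_of_le {t : ℝ} (ht : |t| ≤ 1 / 2) : driftFactor t = 2 := by
  rw [driftFactor, min_eq_left (by linarith), max_eq_right zero_le_one, mul_one]

theorem driftFactor_of_ge {t : ℝ} (ht : 5 / 8 ≤ |t|) : driftFactor t = 0 := by
  rw [driftFactor, min_eq_right (by linarith), max_eq_left (by linarith), mul_zero]

theorem profile_of_le {t : ℝ} (ht : |t| ≤ 1 / 2) : profile b t = 2 * slopePoint (2 * t) := by
  rw [profile_eq_drift, driftFactor_of_le ht, Complex.ofReal_ofNat]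
  intro k i _
  by_contra! h
  have h1 := mem_Ioo_of_abs_sub_bumpCenter_lt (p := Nat.pair k i) (t := t)
    (by linarith [bumpRadius_pos (Nat.pair k i)])
  linarith [(abs_le.1 ht).2]

theorem profile_of_ge {t : ℝ} (ht : 1 ≤ |t|) : profile b t = 0 := by
  rw [profile_eq_drift, driftFactor_of_ge (by linarith), Complex.ofReal_zero, zero_mul]
  intro k i _
  by_contra! h
  have h1 := mem_Ioo_of_abs_sub_bumpCenter_lt (p := Nat.pair k i) (t := t)
    (by linarith [bumpRadius_pos (Nat.pair k i)])
  rw [abs_of_pos (by linarith)] at ht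
  linarith

theorem profile_of_mem_bump {k i : ℕ} (hi : i < (b k).natAbs) {t : ℝ}
    (ht : |t - bumpCenter (Nat.pair k i)| < bumpRadius (Nat.pair k i)) :
    profile b t = jump k (Nat.pair k i) (returnMultiplier (b k)) t := by
  have h0 : ∀ l j, (l ≠ k ∨ j ≠ i) → jump l (Nat.pair l j) (returnMultiplier (b l)) t = 0 := by
    intro l j hlj
    refine jump_eq_zero fun h => ?_
    have := Nat.pair_eq_pair.1 (bump_disjoint (t := t) (p := Nat.pair l j)
      (by linarith [abs_nonneg (t - bumpCenter (Nat.pair l j))]) ht)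
    tauto
  have h1 := mem_Ioo_of_abs_sub_bumpCenter_lt (p := Nat.pair k i) (t := t)
    (by linarith [bumpRadius_pos (Nat.pair k i)])
  rw [profile, driftFactor_of_ge (by rw [abs_of_pos (by linarith)]; linarith), Complex.ofReal_zero,
    zero_mul, zero_add, tsum_eq_single k, Finset.sum_eq_single_of_mem i (Finset.mem_range.2 hi)]
  · exact fun j _ hj => h0 k j (Or.inr hj)
  · exact fun l hl => Finset.sum_eq_zero fun j _ => h0 l j (Or.inl hl)

theorem exists_norm_profile_le : ∃ C, ∀ t, ‖profile b t‖ ≤ C := by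
  obtain ⟨C, hC⟩ := (isCompact_Icc (a := (-1 : ℝ)) (b := 1)).exists_bound_of_continuousOn
    (continuous_profile (b := b)).continuousOn
  refine ⟨max C 0, fun t => ?_⟩
  rcases le_total 1 |t| with h | h
  · rw [profile_of_ge h, norm_zero]
    exact le_max_right _ _
  · exact (hC t (abs_le.1 h)).trans (le_max_left _ _)

end Profile

section PlanarMap

variable {b : ℕ → ℤ}

theorem planarMap_of_re_nonpos {z : ℂ} (hz : z.re ≤ 0) : planarMap b z = 0 := by
  rw [planarMap, max_eq_right hz, Complex.ofReal_zero, zero_mul]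

theorem planarMap_slopePoint (t : ℝ) : planarMap b (slopePoint t) = profile b t := by
  simp [planarMap, slopePoint]

theorem planarMap_real_mul {r : ℝ} (hr : 0 ≤ r) (z : ℂ) :
    planarMap b (r * z) = r * planarMap b z := by
  rcases hr.eq_or_lt with rfl | hr
  · simp [planarMap]
  · rw [planarMap, planarMap, Complex.re_ofReal_mul, Complex.im_ofReal_mul,
      mul_div_mul_left _ _ hr.ne', ← mul_assoc, ← Complex.ofReal_mul,
      mul_max_of_nonneg _ _ hr.le, mul_zero]

theorem continuous_planarMap : Continuous (planarMap b) := by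
  rw [continuous_iff_continuousAt]
  intro z
  by_cases hz : z.re = 0
  · obtain ⟨C, hC⟩ := exists_norm_profile_le (b := b)
    rw [ContinuousAt, planarMap_of_re_nonpos hz.le]
    refine squeeze_zero_norm (a := fun w : ℂ => max w.re 0 * C) (fun w => ?_) ?_
    · rw [planarMap, norm_mul, Complex.norm_real, Real.norm_of_nonneg (le_max_right _ _)]
      exact mul_le_mul_of_nonneg_left (hC _) (le_max_right _ _)
    · have : Continuous fun w : ℂ => max w.re 0 * C := by fun_prop
      simpa [hz] using this.tendsto z
  · have h1 : ContinuousAt (fun w : ℂ => w.im / w.re) z :=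
      Complex.continuous_im.continuousAt.div Complex.continuous_re.continuousAt hz
    have h2 : ContinuousAt (fun w : ℂ => profile b (w.im / w.re)) z :=
      continuous_profile.continuousAt.comp h1
    have h3 : Continuous fun w : ℂ => ((max w.re 0 : ℝ) : ℂ) := by fun_prop
    exact h3.continuousAt.mul h2

theorem iterate_planarMap_real_mul {r : ℝ} (hr : 0 ≤ r) (n : ℕ) (z : ℂ) :
    (planarMap b)^[n] (r * z) = r * (planarMap b)^[n] z := by
  induction n generalizing z with
  | zero => rfl
  | succ n ih => rw [Function.iterate_succ_apply, planarMap_real_mul hr, ih,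
      Function.iterate_succ_apply]

theorem iterate_planarMap_zero (n : ℕ) : (planarMap b)^[n] 0 = 0 := by
  simpa using iterate_planarMap_real_mul (b := b) le_rfl n 0

theorem iterate_planarMap_of_re_nonpos {n : ℕ} (hn : n ≠ 0) {z : ℂ} (hz : z.re ≤ 0) :
    (planarMap b)^[n] z = 0 := by
  obtain ⟨n, rfl⟩ := Nat.exists_eq_succ_of_ne_zero hn
  rw [Function.iterate_succ_apply, planarMap_of_re_nonpos hz, iterate_planarMap_zero]

/-! ### The orbits of the planar map -/

theorem iterate_planarMap_drift (j : ℕ) {t : ℝ} (ht : 2 ^ j * |t| ≤ 1) :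
    (planarMap b)^[j] (slopePoint t) = ((2 ^ j : ℝ) : ℂ) * slopePoint (2 ^ j * t) := by
  induction j with
  | zero => simp
  | succ j ih =>
    have h1 : 2 ^ j * |t| ≤ 1 / 2 := by
      rw [pow_succ] at ht; linarith
    rw [Function.iterate_succ_apply', ih (by linarith), planarMap_real_mul (by positivity),
      planarMap_slopePoint, profile_of_le (by rwa [abs_mul, abs_of_pos (by positivity)])]
    push_cast
    ring_nf

/-- The orbit of a point of a bump until its first return to the ray of slope `R u`. -/
theorem iterate_planarMap_bump {k i : ℕ} (hi : i < (b k).natAbs) {u : ℝ}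
    (hu : |u - bumpCenter (Nat.pair k i)| < bumpRadius (Nat.pair k i)) {l : ℕ} (hl : l ≤ k) :
    (planarMap b)^[l + 1] (slopePoint u) =
      ((2 * (1 / 2) ^ (k - l) * tent (Nat.pair k i) u : ℝ) : ℂ) *
        slopePoint ((1 / 2) ^ (k - l) * (bumpCenter (Nat.pair k i) +
          returnMultiplier (b k) * (u - bumpCenter (Nat.pair k i)))) := by
  set p := Nat.pair k i
  set v := bumpCenter p + returnMultiplier (b k) * (u - bumpCenter p) with hv
  have hv1 : |v| ≤ 1 := by
    have := mem_Ioo_of_abs_sub_bumpCenter_lt (p := p) (t := v) (by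
      rw [hv, add_sub_cancel_left]
      exact abs_returnMultiplier_mul_lt (by linarith [bumpRadius_pos p]) (by linarith))
    rw [abs_of_pos (by linarith)]
    exact this.2.le
  have hpow : ((1 : ℝ) / 2) ^ k = (1 / 2) ^ (k - l) * (1 / 2) ^ l := by
    rw [← pow_add, Nat.sub_add_cancel hl]
  have h2 : (2 : ℝ) ^ l * (1 / 2) ^ l = 1 := by
    rw [← mul_pow]; norm_num
  have h1 : (2 : ℝ) ^ l * (1 / 2) ^ k = (1 / 2) ^ (k - l) := by
    rw [hpow, mul_left_comm, h2, mul_one]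
  rw [Function.iterate_succ_apply, planarMap_slopePoint, profile_of_mem_bump hi hu, jump,
    iterate_planarMap_real_mul (mul_nonneg (by positivity) (tent_nonneg _ _)),
    iterate_planarMap_drift, ← mul_assoc, ← Complex.ofReal_mul, ← mul_assoc, h1, ← h1]
  · congr 2
    ring
  · rw [abs_mul, abs_of_pos (by positivity), ← mul_assoc, h1]
    exact mul_le_one₀ (pow_le_one₀ (by norm_num) (by norm_num)) (abs_nonneg _) hv1

/-- The orbit of a point of a bump, after `Q` returns and `l + 1` further steps. The slopes of the
returns are the iterates of the affine return map, and the orbit is at `0` once a return is outside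
of the bump. -/
theorem iterate_planarMap_bump_returns {k i : ℕ} (hi : i < (b k).natAbs) {u : ℝ}
    (hu : |u - bumpCenter (Nat.pair k i)| < bumpRadius (Nat.pair k i)) (Q : ℕ) {l : ℕ}
    (hl : l ≤ k) :
    ∃ μ : ℝ, 0 ≤ μ ∧ (planarMap b)^[(k + 1) * Q + (l + 1)] (slopePoint u) = μ * slopePoint
      ((1 / 2) ^ (k - l) * (bumpCenter (Nat.pair k i) +
        returnMultiplier (b k) ^ (Q + 1) * (u - bumpCenter (Nat.pair k i)))) ∧
      (μ ≠ 0 → |returnMultiplier (b k) ^ (Q + 1) * (u - bumpCenter (Nat.pair k i))| <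
        bumpRadius (Nat.pair k i)) ∧
      (u = bumpCenter (Nat.pair k i) → μ = 2 ^ (Q + 1) * (1 / 2) ^ (k - l)) := by
  generalize hp : Nat.pair k i = p at *
  generalize hm : returnMultiplier (b k) = m
  have step : ∀ Q l, l ≤ k →
      (∃ μ : ℝ, 0 ≤ μ ∧ (planarMap b)^[(k + 1) * Q] (slopePoint u) =
        μ * slopePoint (bumpCenter p + m ^ Q * (u - bumpCenter p)) ∧
        (μ ≠ 0 → |m ^ Q * (u - bumpCenter p)| < bumpRadius p) ∧
        (u = bumpCenter p → μ = 2 ^ Q)) →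
      ∃ μ : ℝ, 0 ≤ μ ∧ (planarMap b)^[(k + 1) * Q + (l + 1)] (slopePoint u) =
        μ * slopePoint ((1 / 2) ^ (k - l) * (bumpCenter p + m ^ (Q + 1) * (u - bumpCenter p))) ∧
        (μ ≠ 0 → |m ^ (Q + 1) * (u - bumpCenter p)| < bumpRadius p) ∧
        (u = bumpCenter p → μ = 2 ^ (Q + 1) * (1 / 2) ^ (k - l)) := by
    rintro Q l hl ⟨μ, hμ0, hμ, hμu, hμc⟩
    by_cases h0 : μ = 0
    · refine ⟨0, le_rfl, ?_, fun h => absurd rfl h, fun h => ?_⟩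
      · rw [add_comm, Function.iterate_add_apply, hμ, h0]
        simp [iterate_planarMap_zero]
      · have := hμc h
        rw [h0] at this
        exact absurd this.symm (by positivity)
    · have hv := hμu h0
      set v := bumpCenter p + m ^ Q * (u - bumpCenter p) with hvdef
      have hv1 : v - bumpCenter p = m ^ Q * (u - bumpCenter p) := by
        rw [hvdef, add_sub_cancel_left]
      have hstep := iterate_planarMap_bump (b := b) hi (u := v) (by rwa [hp, hv1]) hl
      rw [hp, hm, hv1] at hstep
      refine ⟨μ * (2 * (1 / 2) ^ (k - l) * tent p v),
        mul_nonneg hμ0 (mul_nonneg (by positivity) (tent_nonneg _ _)), ?_, fun h => ?_,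
        fun h => ?_⟩
      · rw [add_comm, Function.iterate_add_apply, hμ, iterate_planarMap_real_mul hμ0, hstep,
          pow_succ' m, mul_assoc m, Complex.ofReal_mul μ, mul_assoc (μ : ℂ)]
      · have h1 : tent p v ≠ 0 := fun h' => h (by rw [h']; ring)
        have h2 := abs_sub_lt_of_tent_ne_zero h1
        rw [hv1] at h2
        rw [pow_succ', mul_assoc, ← hm]
        rw [← hm] at h2
        exact abs_returnMultiplier_mul_lt (bumpRadius_pos p) h2
      · have h1 : v = bumpCenter p := by rw [hvdef, h]; ring
        rw [h1, tent_bumpCenter, hμc h]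
        ring
  refine step Q l hl ?_
  clear hl l
  induction Q with
  | zero => exact ⟨1, zero_le_one, by simp, by simpa using hu, by simp⟩
  | succ Q ih => simpa [mul_add] using step Q k le_rfl ih

end PlanarMap

/-! ### The winding number of the displacement of an iterate -/

theorem slopeForm_mul_slopePoint (x t t₀ : ℝ) : slopeForm t₀ (x * slopePoint t) = x * (t - t₀) := by
  simp [slopeForm, slopePoint]
  ring

theorem one_sub_slopePoint_div (lam s t : ℝ) :
    1 - lam * slopePoint s / slopePoint t =
      ⟨1 - lam * (1 + t * s) / (1 + t ^ 2), lam * (t - s) / (1 + t ^ 2)⟩ := by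
  have h : (1 + t ^ 2 : ℝ) ≠ 0 := by positivity
  apply Complex.ext
  · simp [slopePoint, Complex.div_re, Complex.normSq_apply]
    field_simp
  · simp [slopePoint, Complex.div_im, Complex.normSq_apply]
    field_simp

/-- The winding number of `z - F z` for a positively homogeneous map `F` that is `0` on the left
half-plane and maps the right half-plane to itself. The ray of slope `t` is multiplied by `lam` and
mapped to the ray of slope `s`; each ray that is mapped into itself contributes `σ i = 1` if
`s - t` changes its sign from `-` to `+`, and `σ i = -1` if it does so from `+` to `-`. -/
theorem hasWinding_sub_of_slopes {ι : Type*} (T : Finset ι) (σ : ι → ℤ) (t δ : ι → ℝ)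
    (hσ : ∀ i ∈ T, σ i = 1 ∨ σ i = -1) (hδ : ∀ i ∈ T, 0 < δ i)
    (hdisj : ∀ x, ∀ i ∈ T, ∀ j ∈ T, |x - t i| < δ i → |x - t j| < δ j → i = j)
    {F : ℂ → ℂ} (hF : Continuous F) (hom : ∀ (r : ℝ) (z : ℂ), 0 ≤ r → F (r * z) = r * F z)
    (hleft : ∀ z : ℂ, z.re ≤ 0 → F z = 0)
    (hray : ∀ x : ℝ, ∃ lam s : ℝ, 0 ≤ lam ∧ F (slopePoint x) = lam * slopePoint s ∧
      ((∀ i ∈ T, δ i ≤ |x - t i|) → lam = 0 ∨ s ≠ x) ∧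
      ∀ i ∈ T, |x - t i| < δ i → (x = t i → s = x ∧ 1 < lam) ∧
        (x ≠ t i → lam = 0 ∨ (x - s) * (σ i * (x - t i)) < 0)) :
    HasWinding (fun z => z - F z) (1 + ∑ i ∈ T, σ i) := by
  have key : HasWinding (fun z : Circle => 1 - F z / z) (∑ i ∈ T, σ i) := by
    have hpolar : ∀ z : Circle, 0 < (z : ℂ).re →
        (z : ℂ) = ((z : ℂ).re : ℂ) * slopePoint ((z : ℂ).im / (z : ℂ).re) := by
      intro z hz
      have := hz.ne'
      apply Complex.ext
      · simp [slopePoint]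
      · simp [slopePoint]
        field_simp
    have hform : ∀ z : Circle, 0 < (z : ℂ).re → ∀ t₀, slopeForm t₀ z =
        (z : ℂ).re * ((z : ℂ).im / (z : ℂ).re - t₀) := by
      intro z hz t₀
      conv_lhs => rw [hpolar z hz]
      rw [slopeForm_mul_slopePoint]
    have hsector : ∀ z : Circle, ∀ t₀ ε : ℝ, 0 < ε → (|slopeForm t₀ z| < ε * (z : ℂ).re ↔
        0 < (z : ℂ).re ∧ |(z : ℂ).im / (z : ℂ).re - t₀| < ε) := by
      intro z t₀ ε hε
      by_cases hz : 0 < (z : ℂ).re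
      · rw [hform z hz, abs_mul, abs_of_pos hz, mul_comm ε, mul_lt_mul_iff_right₀ hz]
        simp [hz]
      · simp only [hz, false_and, iff_false, not_lt]
        exact (mul_nonpos_of_nonneg_of_nonpos hε.le (not_lt.1 hz)).trans (abs_nonneg _)
    have hq : ∀ z : Circle, 0 < (z : ℂ).re → ∀ lam s : ℝ,
        F (slopePoint ((z : ℂ).im / (z : ℂ).re)) = lam * slopePoint s →
        1 - F z / z = 1 - lam * slopePoint s / slopePoint ((z : ℂ).im / (z : ℂ).re) := by
      intro z hz lam s h
      have hz0 : ((z : ℂ).re : ℂ) ≠ 0 := by exact_mod_cast hz.ne'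
      conv_lhs => rw [hpolar z hz, hom _ _ hz.le, h, mul_div_mul_left _ _ hz0]
    refine hasWinding_of_crossings T σ t δ hσ hδ ?_ ?_ ?_ ?_
    · intro z i hi j hj hiz hjz
      rw [hsector z _ _ (hδ i hi)] at hiz
      rw [hsector z _ _ (hδ j hj)] at hjz
      exact hdisj _ i hi j hj hiz.2 hjz.2
    · exact continuous_const.sub ((hF.comp continuous_subtype_val).div continuous_subtype_val
        Circle.coe_ne_zero)
    · intro z hz
      by_cases hz0 : 0 < (z : ℂ).re
      · obtain ⟨lam, s, hlam, hs, hout, -⟩ := hray ((z : ℂ).im / (z : ℂ).re)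
        rw [hq z hz0 lam s hs, one_sub_slopePoint_div, Complex.mem_slitPlane_iff]
        rcases hout fun i hi => by
          by_contra! h
          exact absurd (hz i hi) (not_le.2 ((hsector z _ _ (hδ i hi)).2 ⟨hz0, h⟩)) with h | h
        · left
          simp [h]
        · rcases hlam.eq_or_lt with h0 | h0
          · left
            simp [← h0]
          · right
            exact div_ne_zero (mul_ne_zero h0.ne' (sub_ne_zero.2 h.symm)) (by positivity)
      · rw [hleft _ (not_lt.1 hz0)]
        simp
    · intro z i hi hiz
      rw [hsector z _ _ (hδ i hi)] at hiz
      obtain ⟨hz0, hiz⟩ := hiz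
      obtain ⟨lam, s, hlam, hs, -, hin⟩ := hray ((z : ℂ).im / (z : ℂ).re)
      rw [hq z hz0 lam s hs, one_sub_slopePoint_div, hform z hz0]
      set x := (z : ℂ).im / (z : ℂ).re
      obtain ⟨h1, h2⟩ := hin i hi hiz
      have hx : (0 : ℝ) < 1 + x ^ 2 := by positivity
      by_cases hxt : x = t i
      · obtain ⟨hsx, hl⟩ := h1 hxt
        left
        refine ⟨by rw [hxt]; ring, by rw [hsx]; simp, ?_⟩
        change 1 - lam * (1 + x * s) / (1 + x ^ 2) < 0
        rw [hsx, ← sq, mul_div_cancel_right₀ _ hx.ne']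
        linarith
      · right
        refine ⟨mul_ne_zero hz0.ne' (sub_ne_zero.2 hxt), ?_⟩
        rcases hlam.eq_or_lt with h0 | h0
        · left
          simp [← h0]
        · right
          have h3 := (h2 hxt).resolve_left h0.ne'
          have h4 : lam * (x - s) / (1 + x ^ 2) * (σ i * ((z : ℂ).re * (x - t i))) =
              lam * (z : ℂ).re / (1 + x ^ 2) * ((x - s) * (σ i * (x - t i))) := by
            field_simp
          change lam * (x - s) / (1 + x ^ 2) * (σ i * ((z : ℂ).re * (x - t i))) < 0
          rw [h4]
          exact mul_neg_of_pos_of_neg (by positivity) h3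
  convert HasWinding.coe.mul key using 2 with z
  field_simp [z.coe_ne_zero]

section Rays

variable (b : ℕ → ℤ) (n : ℕ)

/-- The rays that the `n`-th iterate of the planar map sends into themselves: `none` is the ray of
slope `0`, and `⟨k, i, j⟩` is the `j`-th preimage under the drift of the ray through the centre of
the bump `i` of period `k + 1`. -/
def fixedRays : Finset (Option (Σ _ : ℕ, ℕ × ℕ)) :=
  Finset.insertNone (((Finset.range n).filter fun k => k + 1 ∣ n).sigma fun k =>
    Finset.range (b k).natAbs ×ˢ Finset.range (k + 1))

/-- The contribution of a fixed ray to the winding number. -/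
def raySign : Option (Σ _ : ℕ, ℕ × ℕ) → ℤ
  | none => 1
  | some x => if 0 < b x.1 then 1 else -1

/-- The slope of a fixed ray. -/
noncomputable def raySlope : Option (Σ _ : ℕ, ℕ × ℕ) → ℝ
  | none => 0
  | some x => (1 / 2) ^ x.2.2 * bumpCenter (Nat.pair x.1 x.2.1)

/-- The half-width of a sector about a fixed ray. -/
noncomputable def rayWidth : Option (Σ _ : ℕ, ℕ × ℕ) → ℝ
  | none => (1 / 2) ^ n
  | some x => (1 / 2) ^ x.2.2 * bumpRadius (Nat.pair x.1 x.2.1)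

variable {b n}

theorem some_mem_fixedRays (hn : n ≠ 0) {k i j : ℕ} :
    some ⟨k, i, j⟩ ∈ fixedRays b n ↔ k + 1 ∣ n ∧ i < (b k).natAbs ∧ j ≤ k := by
  simp only [fixedRays, Finset.some_mem_insertNone, Finset.mem_sigma, Finset.mem_filter,
    Finset.mem_range, Finset.mem_product, Order.lt_add_one_iff]
  constructor
  · rintro ⟨⟨-, h1⟩, h2⟩
    exact ⟨h1, h2⟩
  · rintro ⟨h1, h2⟩
    exact ⟨⟨Nat.le_of_dvd (Nat.pos_of_ne_zero hn) h1, h1⟩, h2⟩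

theorem sum_raySign : ∑ x ∈ fixedRays b n, raySign b x =
    1 + ∑ k ∈ (Finset.range n).filter (fun k => k + 1 ∣ n), ((k : ℤ) + 1) * b k := by
  rw [fixedRays, Finset.sum_insertNone, Finset.sum_sigma]
  congr 1
  refine Finset.sum_congr rfl fun k _ => ?_
  simp only [raySign]
  split_ifs with h <;>
    simp only [Finset.sum_const, Finset.card_product, Finset.card_range, nsmul_eq_mul]
  · push_cast
    rw [abs_of_pos h]
    ring
  · push_cast
    rw [abs_of_nonpos (not_lt.1 h)]
    ring

theorem abs_sub_raySlope_lt_iff {k i j : ℕ} {x : ℝ} :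
    |x - raySlope (some ⟨k, i, j⟩)| < rayWidth n (some ⟨k, i, j⟩) ↔
      |2 ^ j * x - bumpCenter (Nat.pair k i)| < bumpRadius (Nat.pair k i) := by
  have h2 : (2 : ℝ) ^ j * (1 / 2) ^ j = 1 := by
    rw [← mul_pow]; norm_num
  have h0 : (0 : ℝ) < 2 ^ j := by positivity
  rw [← mul_lt_mul_iff_right₀ h0, ← abs_of_pos h0, ← abs_mul, abs_of_pos h0, mul_sub, raySlope,
    rayWidth, ← mul_assoc, ← mul_assoc, h2, one_mul, one_mul]

theorem dyadic_unique {j l : ℕ} {x : ℝ} (hj : 1 / 2 < 2 ^ j * x) (hj' : 2 ^ j * x ≤ 1)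
    (hl : 1 / 2 < 2 ^ l * x) (hl' : 2 ^ l * x ≤ 1) : j = l := by
  wlog h : j < l generalizing j l
  · rcases eq_or_lt_of_not_gt h with h | h
    · exact h.symm
    · exact (this hl hl' hj hj' h).symm
  have h1 : (2 : ℝ) ^ (j + 1) ≤ 2 ^ l := pow_le_pow_right₀ one_le_two h
  have h2 : 0 < x := by
    by_contra! h2
    have : 2 ^ j * x ≤ 0 := mul_nonpos_of_nonneg_of_nonpos (by positivity) h2
    linarith
  have h3 := mul_le_mul_of_nonneg_right h1 h2.le
  rw [pow_succ] at h3
  linarith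

theorem mem_Ioo_of_mem_sector {k i j : ℕ} {x : ℝ}
    (h : |x - raySlope (some ⟨k, i, j⟩)| < rayWidth n (some ⟨k, i, j⟩)) :
    3 / 4 < 2 ^ j * x ∧ 2 ^ j * x < 1 := by
  rw [abs_sub_raySlope_lt_iff] at h
  exact mem_Ioo_of_abs_sub_bumpCenter_lt (h.trans (by linarith [bumpRadius_pos (Nat.pair k i)]))

theorem not_mem_sector_some (hn : n ≠ 0) {k i j : ℕ} {x : ℝ} (hx : |x| ≤ (1 / 2) ^ n)
    (hm : some ⟨k, i, j⟩ ∈ fixedRays b n) :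
    ¬ |x - raySlope (some ⟨k, i, j⟩)| < rayWidth n (some ⟨k, i, j⟩) := by
  intro h
  have h1 := (mem_Ioo_of_mem_sector h).1
  rw [some_mem_fixedRays hn] at hm
  have hkn := Nat.le_of_dvd (Nat.pos_of_ne_zero hn) hm.1
  have h2 : (2 : ℝ) ^ (j + 1) ≤ 2 ^ n := pow_le_pow_right₀ one_le_two (by omega)
  have h3 : (2 : ℝ) ^ n * (1 / 2) ^ n = 1 := by
    rw [← mul_pow]; norm_num
  have h4 : (2 : ℝ) ^ (j + 1) * |x| ≤ 2 ^ n * (1 / 2) ^ n :=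
    mul_le_mul h2 hx (abs_nonneg x) (by positivity)
  have h5 : (2 : ℝ) ^ j * x ≤ 2 ^ j * |x| :=
    mul_le_mul_of_nonneg_left (le_abs_self x) (by positivity)
  rw [pow_succ] at h4
  linarith

theorem raySectors_disjoint (hn : n ≠ 0) (x : ℝ) : ∀ i ∈ fixedRays b n, ∀ j ∈ fixedRays b n,
    |x - raySlope i| < rayWidth n i → |x - raySlope j| < rayWidth n j → i = j := by
  have hnone : |x - raySlope none| < rayWidth n none → |x| ≤ (1 / 2) ^ n := fun h => by
    simpa [raySlope, rayWidth] using h.le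
  rintro (_ | ⟨k, i, j⟩) h1 (_ | ⟨k', i', j'⟩) h2 h3 h4
  · rfl
  · exact absurd h4 (not_mem_sector_some hn (hnone h3) h2)
  · exact absurd h3 (not_mem_sector_some hn (hnone h4) h1)
  · obtain ⟨a1, a2⟩ := mem_Ioo_of_mem_sector h3
    obtain ⟨b1, b2⟩ := mem_Ioo_of_mem_sector h4
    obtain rfl := dyadic_unique (by linarith) a2.le (by linarith) b2.le
    rw [abs_sub_raySlope_lt_iff] at h3 h4
    obtain ⟨rfl, rfl⟩ := Nat.pair_eq_pair.1 (bump_disjoint h3 h4)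
    rfl

end Rays

section Index

variable {b : ℕ → ℤ} {n : ℕ}

/-- A slope outside `[-2 ^ (-n), 2 ^ (-n)]` leaves the region of the pure drift within `n` steps. -/
theorem exists_drift_time {N : ℕ} {x : ℝ} (hx : (1 / 2) ^ (N + 1) < |x|) :
    ∃ j ≤ N, 1 / 2 < 2 ^ j * |x| ∧ (j = 0 ∨ 2 ^ j * |x| ≤ 1) := by
  classical
  have hN : 1 / 2 < 2 ^ N * |x| := by
    have h2 : (2 : ℝ) ^ N * (1 / 2) ^ N = 1 := by
      rw [← mul_pow]; norm_num
    have := mul_lt_mul_of_pos_left hx (by positivity : (0 : ℝ) < 2 ^ N)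
    rw [pow_succ, ← mul_assoc, h2, one_mul] at this
    exact this
  have hex : ∃ j, 1 / 2 < 2 ^ j * |x| := ⟨N, hN⟩
  refine ⟨Nat.find hex, Nat.find_min' hex hN, Nat.find_spec hex, ?_⟩
  rcases Nat.eq_zero_or_pos (Nat.find hex) with h | h
  · exact Or.inl h
  · right
    have := not_lt.1 (Nat.find_min hex (Nat.sub_lt h one_pos))
    obtain ⟨j, hj⟩ := Nat.exists_eq_succ_of_ne_zero h.ne'
    rw [hj] at this ⊢
    rw [Nat.succ_sub_one] at this
    rw [Nat.succ_eq_add_one, pow_succ]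
    linarith

/-- The action of the `n`-th iterate of the planar map on the ray of slope `x`. -/
theorem iterate_planarMap_slopePoint (hn : n ≠ 0) (x : ℝ) :
    ∃ lam s : ℝ, 0 ≤ lam ∧ (planarMap b)^[n] (slopePoint x) = lam * slopePoint s ∧
      ((∀ i ∈ fixedRays b n, rayWidth n i ≤ |x - raySlope i|) → lam = 0 ∨ s ≠ x) ∧
      ∀ i ∈ fixedRays b n, |x - raySlope i| < rayWidth n i →
        (x = raySlope i → s = x ∧ 1 < lam) ∧
        (x ≠ raySlope i → lam = 0 ∨ (x - s) * (raySign b i * (x - raySlope i)) < 0) := by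
  obtain ⟨N, rfl⟩ := Nat.exists_eq_succ_of_ne_zero hn
  rw [Nat.succ_eq_add_one] at *
  have h2pow : ∀ j : ℕ, (2 : ℝ) ^ j * (1 / 2) ^ j = 1 := fun j => by
    rw [← mul_pow]; norm_num
  have hone : (1 : ℝ) < 2 ^ (N + 1) := one_lt_pow₀ one_lt_two hn
  rcases le_or_gt |x| ((1 / 2) ^ (N + 1)) with hx | hx
  · -- pure drift
    refine ⟨2 ^ (N + 1), 2 ^ (N + 1) * x, by positivity, iterate_planarMap_drift (N + 1) ?_, ?_, ?_⟩
    · have := mul_le_mul_of_nonneg_left hx (by positivity : (0 : ℝ) ≤ 2 ^ (N + 1))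
      rwa [h2pow] at this
    · intro h
      right
      have h1 := h none (by simp [fixedRays])
      simp only [raySlope, rayWidth, sub_zero] at h1
      have h0 : x ≠ 0 := by
        rintro rfl
        rw [abs_zero] at h1
        exact absurd h1 (not_le.2 (by positivity))
      intro h2
      exact hone.ne' (mul_right_cancel₀ h0 (h2.trans (one_mul x).symm))
    · rintro (_ | ⟨k, i, j⟩) hm hi
      · simp only [raySlope, raySign, sub_zero, Int.cast_one, one_mul]
        refine ⟨fun h => ⟨by rw [h, mul_zero], hone⟩, fun h => Or.inr ?_⟩
        have h3 : (x - 2 ^ (N + 1) * x) * x = (1 - 2 ^ (N + 1)) * x ^ 2 := by ring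
        rw [h3]
        exact mul_neg_of_neg_of_pos (by linarith) (by positivity)
      · exact absurd hi (not_mem_sector_some hn hx hm)
  · obtain ⟨j, hjN, hj, hj1⟩ := exists_drift_time hx
    have hx0 : x ≠ 0 := by
      rintro rfl
      rw [abs_zero] at hx
      exact absurd hx (not_lt.2 (by positivity))
    have hnone : ¬ |x - raySlope none| < rayWidth (N + 1) none := by
      simpa only [raySlope, rayWidth, sub_zero, not_lt] using hx.le
    -- the sectors about the fixed rays consist of rays that drift to a bump after `j` steps
    have hsome : ∀ k i l, |x - raySlope (some ⟨k, i, l⟩)| < rayWidth (N + 1) (some ⟨k, i, l⟩) →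
        l = j := by
      intro k i l h
      obtain ⟨h1, h2⟩ := mem_Ioo_of_mem_sector h
      have hxpos : 0 < x := by
        by_contra! h0
        have : 2 ^ l * x ≤ 0 := mul_nonpos_of_nonneg_of_nonpos (by positivity) h0
        linarith
      rw [abs_of_pos hxpos] at hj hj1
      rcases hj1 with rfl | hj1
      · have h3 : 1 * x ≤ 2 ^ l * x :=
          mul_le_mul_of_nonneg_right (one_le_pow₀ one_le_two) hxpos.le
        exact dyadic_unique (by linarith) h2.le hj (by rw [pow_zero]; linarith)
      · exact dyadic_unique (by linarith) h2.le hj hj1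
    have hdrift : (planarMap b)^[j] (slopePoint x) = ((2 ^ j : ℝ) : ℂ) * slopePoint (2 ^ j * x) := by
      rcases hj1 with rfl | hj1
      · simp
      · exact iterate_planarMap_drift j hj1
    set w := 2 ^ j * x with hw
    have hxw : x = (1 / 2) ^ j * w := by
      rw [hw, ← mul_assoc, mul_comm _ (2 ^ j), h2pow, one_mul]
    have hwabs : 1 / 2 < |w| := by
      rwa [hw, abs_mul, abs_of_pos (by positivity)]
    by_cases hbump : ∃ k i, i < (b k).natAbs ∧
        |w - bumpCenter (Nat.pair k i)| < bumpRadius (Nat.pair k i)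
    · obtain ⟨k, i, hi, hwu⟩ := hbump
      set Q := (N - j) / (k + 1)
      set l := (N - j) % (k + 1)
      have hl : l ≤ k := Nat.lt_succ_iff.1 (Nat.mod_lt _ (Nat.succ_pos k))
      have hdiv : (k + 1) * Q + l = N - j := Nat.div_add_mod _ _
      have hN : N + 1 = (k + 1) * Q + (l + 1) + j := by omega
      obtain ⟨μ, hμ0, hμ, hμu, hμc⟩ := iterate_planarMap_bump_returns hi hwu Q hl
      set c := bumpCenter (Nat.pair k i) with hc
      set m := returnMultiplier (b k) with hm
      refine ⟨2 ^ j * μ, (1 / 2) ^ (k - l) * (c + m ^ (Q + 1) * (w - c)),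
        mul_nonneg (by positivity) hμ0, ?_, ?_, ?_⟩
      · rw [hN, Function.iterate_add_apply, hdrift, iterate_planarMap_real_mul (by positivity), hμ,
          Complex.ofReal_mul, mul_assoc]
      · intro hout
        by_contra! h
        obtain ⟨h1, h2⟩ := h
        have hμ1 : μ ≠ 0 := fun h => h1 (by rw [h, mul_zero])
        have hv := mem_Ioo_of_abs_sub_bumpCenter_lt (p := Nat.pair k i)
          (t := c + m ^ (Q + 1) * (w - c)) (by
            rw [← hc, add_sub_cancel_left]
            linarith [hμu hμ1, bumpRadius_pos (Nat.pair k i)])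
        have hw1 := mem_Ioo_of_abs_sub_bumpCenter_lt (p := Nat.pair k i) (t := w)
            (by linarith [bumpRadius_pos (Nat.pair k i)])
        have h3 : k - l = j := by
          refine dyadic_unique (x := x) ?_ ?_ (by linarith) (by linarith)
          · rw [← h2, ← mul_assoc, h2pow, one_mul]; linarith
          · rw [← h2, ← mul_assoc, h2pow, one_mul]; exact hv.2.le
        have hmem : some ⟨k, i, j⟩ ∈ fixedRays b (N + 1) := by
          rw [some_mem_fixedRays hn]
          refine ⟨⟨Q + 1, ?_⟩, hi, by omega⟩
          rw [hN, mul_add]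
          omega
        exact absurd (abs_sub_raySlope_lt_iff.2 hwu) (not_lt.2 (hout _ hmem))
      · rintro (_ | ⟨k', i', j'⟩) hmem hsec
        · exact absurd hsec hnone
        · obtain rfl := hsome _ _ _ hsec
          obtain ⟨rfl, rfl⟩ := Nat.pair_eq_pair.1
            (bump_disjoint (abs_sub_raySlope_lt_iff.1 hsec) hwu)
          rw [some_mem_fixedRays hn] at hmem
          obtain ⟨hdvd, -, hjk⟩ := hmem
          have hkl : k' - l = j' := by
            have h1 : k' + 1 ∣ l + 1 + j' := by
              rw [hN, add_assoc] at hdvd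
              exact (Nat.dvd_add_right (dvd_mul_right _ _)).1 hdvd
            obtain ⟨r, hr⟩ := h1
            have hr1 : r = 1 := by
              rcases r with _ | _ | r
              · omega
              · rfl
              · nlinarith
            rw [hr1] at hr
            omega
          rw [hkl]
          have hslope : raySlope (some ⟨k', i', j'⟩) = (1 / 2) ^ j' * c := rfl
          have hpos : (0 : ℝ) < (1 / 2) ^ j' := by positivity
          rw [hslope]
          constructor
          · intro h
            have hwc : w = c := by
              rw [hw, h, ← mul_assoc, h2pow, one_mul]
            refine ⟨?_, ?_⟩
            · rw [hwc, sub_self, mul_zero, add_zero, h]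
            · rw [hμc hwc, hkl, mul_left_comm, h2pow, mul_one]
              exact one_lt_pow₀ one_lt_two (Nat.succ_ne_zero Q)
          · intro h
            right
            have hwc : w - c ≠ 0 := by
              intro h0
              exact h (by rw [hxw, sub_eq_zero.1 h0])
            have h1 : (x - (1 / 2) ^ j' * (c + m ^ (Q + 1) * (w - c))) *
                (raySign b (some ⟨k', i', j'⟩) * (x - (1 / 2) ^ j' * c)) =
                ((1 / 2) ^ j' * (w - c)) ^ 2 * (raySign b (some ⟨k', i', j'⟩) *
                  (1 - m ^ (Q + 1))) := by
              rw [hxw]; ring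
            rw [h1]
            refine mul_neg_of_pos_of_neg (by positivity) ?_
            rw [hm, returnMultiplier, raySign]
            change ((if 0 < b k' then 1 else -1 : ℤ) : ℝ) *
              (1 - (if 0 < b k' then 2 else 0 : ℝ) ^ (Q + 1)) < 0
            split_ifs
            · have : (1 : ℝ) < 2 ^ (Q + 1) := one_lt_pow₀ one_lt_two (Nat.succ_ne_zero Q)
              push_cast
              linarith
            · simp
    · push Not at hbump
      have hno : ∀ i ∈ fixedRays b (N + 1), ¬ |x - raySlope i| < rayWidth (N + 1) i := by
        rintro (_ | ⟨k, i, l⟩) hmem hsec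
        · exact hnone hsec
        · obtain rfl := hsome _ _ _ hsec
          rw [some_mem_fixedRays hn] at hmem
          exact absurd (abs_sub_raySlope_lt_iff.1 hsec) (not_lt.2 (hbump k i hmem.2.1))
      have hfirst : planarMap b (slopePoint w) = driftFactor w * slopePoint (2 * w) := by
        rw [planarMap_slopePoint, profile_eq_drift fun k i hi => hbump k i hi]
      rcases hjN.eq_or_lt with rfl | hlt
      · refine ⟨2 ^ j * driftFactor w, 2 * w, mul_nonneg (by positivity) (driftFactor_nonneg w), ?_,
          fun _ => Or.inr ?_, fun i hi h => absurd h (hno i hi)⟩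
        · rw [Function.iterate_succ_apply', hdrift, planarMap_real_mul (by positivity), hfirst,
            Complex.ofReal_mul, mul_assoc]
        · rw [hw, ← mul_assoc, ← pow_succ']
          intro h
          exact hone.ne' (mul_right_cancel₀ hx0 (h.trans (one_mul x).symm))
      · refine ⟨0, 0, le_rfl, ?_, fun _ => Or.inl rfl, fun i hi h => absurd h (hno i hi)⟩
        obtain ⟨r, hr⟩ := Nat.exists_eq_add_of_lt hlt
        have hN : N + 1 = r + 2 + j := by omega
        have hsecond : (planarMap b)^[2] (slopePoint w) = 0 := by
          rw [Function.iterate_succ_apply, Function.iterate_one, hfirst,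
            planarMap_real_mul (driftFactor_nonneg w), planarMap_slopePoint, profile_of_ge, mul_zero]
          rw [abs_mul, abs_two]
          linarith
        rw [hN, Function.iterate_add_apply, hdrift, iterate_planarMap_real_mul (by positivity),
          Function.iterate_add_apply, hsecond, iterate_planarMap_zero]
        simp

/-- The winding number of the displacement of the iterates of the planar map. One of the two units
is the winding number of the identity, and the other comes from the ray of slope `0`. -/
theorem hasWinding_sub_iterate_planarMap (hn : n ≠ 0) :
    HasWinding (fun z => z - (planarMap b)^[n] z)
      (2 + ∑ k ∈ (Finset.range n).filter (fun k => k + 1 ∣ n), ((k : ℤ) + 1) * b k) := by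
  have h := hasWinding_sub_of_slopes (fixedRays b n) (raySign b) raySlope (rayWidth n)
    (by
      rintro (_ | x) _
      · exact Or.inl rfl
      · simp only [raySign]
        split_ifs <;> simp)
    (by
      rintro (_ | x) _
      · exact pow_pos (by norm_num) n
      · exact mul_pos (by positivity) (bumpRadius_pos _))
    (raySectors_disjoint hn) (continuous_planarMap.iterate n)
    (fun r z hr => iterate_planarMap_real_mul hr n z)
    (fun z hz => iterate_planarMap_of_re_nonpos hn hz)
    (iterate_planarMap_slopePoint hn)
  rw [sum_raySign, ← add_assoc] at h
  exact h

theorem eq_zero_of_iterate_planarMap_eq_self (hn : n ≠ 0) {z : ℂ} (hz : (planarMap b)^[n] z = z) :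
    z = 0 := by
  have h := (hasWinding_sub_iterate_planarMap (b := b) hn).ne_zero (direction z)
  by_contra h0
  have h1 : (‖z‖ : ℂ) ≠ 0 := by simpa using h0
  refine h (sub_eq_zero.2 (mul_left_cancel₀ h1 ?_))
  rw [← iterate_planarMap_real_mul (norm_nonneg z), norm_mul_direction, hz]

end Index

/-! ### The extension to higher dimensions -/

theorem iterate_conj {X Y : Type*} {ι : X → Y} {π : Y → X} (hπ : ∀ z, π (ι z) = z) (g : X → X)
    {n : ℕ} (hn : n ≠ 0) : (fun x => ι (g (π x)))^[n] = fun x => ι (g^[n] (π x)) := by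
  obtain ⟨n, rfl⟩ := Nat.exists_eq_succ_of_ne_zero hn
  induction n with
  | zero => rfl
  | succ n ih =>
    rw [Nat.succ_eq_add_one, Function.iterate_succ', ih n.succ_ne_zero]
    ext x
    rw [Function.comp_apply, hπ, ← Function.iterate_succ_apply' g]

/-- The Dold relations as a sum over the divisors `k + 1` of `n`. -/
theorem DoldRelations.exists_eq_sum {I : ℕ+ → ℤ} (hI : DoldRelations I) :
    ∃ a : ℕ → ℤ, ∀ n : ℕ+, I n =
      ∑ k ∈ (Finset.range n).filter (fun k => k + 1 ∣ (n : ℕ)), ((k : ℤ) + 1) * a k := by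
  obtain ⟨a, ha⟩ := hI
  refine ⟨fun k => a k.succPNat, fun n => ?_⟩
  rw [ha, Finset.sum_filter]
  refine Finset.sum_bij' (fun k _ => k.natPred) (fun k _ => k.succPNat) (fun k hk => ?_)
    (fun k hk => ?_) (fun k _ => PNat.succPNat_natPred k) (fun k _ => Nat.natPred_succPNat k)
    fun k hk => ?_
  · rw [Finset.mem_range, ← Nat.succ_le_iff, ← Nat.add_one, PNat.natPred_add_one]
    exact (Finset.mem_Icc.1 hk).2
  · rw [Finset.mem_Icc]
    refine ⟨one_le, ?_⟩
    rw [← PNat.coe_le_coe, Nat.succPNat_coe]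
    exact Finset.mem_range.1 hk
  · beta_reduce
    rw [PNat.natPred_add_one, PNat.succPNat_natPred, normalizedSeq]
    have h : ((k.natPred : ℤ) + 1) = (k : ℤ) := by
      have := PNat.natPred_add_one k
      exact_mod_cast this
    rw [h]
    split_ifs
    · exact mul_comm _ _
    · exact mul_zero _

theorem theorem1 (d : ℕ) (hd : 2 ≤ d) (I : ℕ+ → ℤ) (hI : DoldRelations I) :
    ∃ (f : Euc d → Euc d) (p : Euc d),
      Continuous f ∧
      Function.IsFixedPt f p ∧
      (∀ n : ℕ+, HasFixedPointIndex (f^[(n : ℕ)]) p (I n)) ∧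
      ¬ AccPt p (Filter.principal (Function.periodicPts f)) ∧
      p = 0 ∧
      Function.periodicPts f = {0} ∧
      Function.fixedPoints f = {0} := by
  obtain ⟨a, ha⟩ := hI.exists_eq_sum
  obtain ⟨ι, π, hπ⟩ := exists_plane_embedding hd
  -- the two units of the index of the planar map are removed from the coefficient of `σ¹`
  let b : ℕ → ℤ := fun k => a k - if k = 0 then 2 else 0
  have hb : ∀ n : ℕ+, 2 + ∑ k ∈ (Finset.range n).filter (fun k => k + 1 ∣ (n : ℕ)),
      ((k : ℤ) + 1) * b k = I n := by
    intro n
    have h0 : 0 ∈ (Finset.range n).filter (fun k => k + 1 ∣ (n : ℕ)) := by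
      simp [n.pos]
    rw [ha, ← Finset.add_sum_erase _ _ h0, ← Finset.add_sum_erase _ _ h0,
      Finset.sum_congr rfl fun k hk => by
        rw [show b k = a k by simp [b, Finset.ne_of_mem_erase hk]]]
    simp only [b, if_true]
    push_cast
    ring
  let f : Euc d → Euc d := fun x => ι (planarMap b (π x))
  have hf : Continuous f := ι.continuous.comp (continuous_planarMap.comp π.continuous)
  have hiter : ∀ {n : ℕ}, n ≠ 0 → f^[n] = fun x => ι ((planarMap b)^[n] (π x)) :=
    fun hn => iterate_conj hπ (planarMap b) hn
  have hfix0 : Function.IsFixedPt f 0 := by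
    have h0 : planarMap b 0 = 0 := planarMap_of_re_nonpos le_rfl
    simp [Function.IsFixedPt, f, h0]
  have hzero : ∀ {n : ℕ}, n ≠ 0 → ∀ x, Function.IsPeriodicPt f n x → x = 0 := by
    intro n hn x hx
    replace hx : ι ((planarMap b)^[n] (π x)) = x := by
      rw [Function.IsPeriodicPt, Function.IsFixedPt, hiter hn] at hx
      exact hx
    have h1 : π x = 0 := eq_zero_of_iterate_planarMap_eq_self hn
      (by rw [← hπ ((planarMap b)^[n] (π x)), hx])
    rw [← hx, h1, iterate_planarMap_zero, map_zero]
  have hper : Function.periodicPts f = {0} := by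
    ext x
    constructor
    · rintro ⟨n, hn, hx⟩
      exact hzero (Nat.pos_iff_ne_zero.1 hn) x hx
    · rintro rfl
      exact ⟨1, one_pos, hfix0.isPeriodicPt 1⟩
  refine ⟨f, 0, hf, hfix0, fun n => ?_, ?_, rfl, hper, ?_⟩
  · rw [hiter n.ne_zero, ← hb n]
    exact hasFixedPointIndex_of_hasWinding hπ (continuous_planarMap.iterate n)
      (fun r z hr => iterate_planarMap_real_mul hr n z)
      (fun z hz => eq_zero_of_iterate_planarMap_eq_self n.ne_zero hz)
      (hasWinding_sub_iterate_planarMap n.ne_zero)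
  · rw [hper, accPt_iff_nhds]
    intro h
    obtain ⟨y, hy, hy0⟩ := h Set.univ Filter.univ_mem
    exact hy0 hy.2
  · ext x
    exact ⟨fun hx => hzero one_ne_zero x hx, by rintro rfl; exact hfix0⟩
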